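/- Let $G_{4,2}$ be the Grassmann manifold of two-dimensional complex subspaces of $\mathbb{C}^4$ with the canonical action of the compact torus $T^4$, and let $T^4$ act on $\mathbb{C}P^5$ through the homomorphism $T^4\to T^6$, $(t_1,t_2,t_3,t_4)\mapsto(t_1t_2,t_1t_3,t_1t_4,t_2t_3,t_2t_4,t_3t_4)$, and the standard action of $T^6$. Let $P\colon G_{4,2}\to\mathbb{C}P^5$ be the Plücker map, which sends the span of the columns of a $4\times2$ matrix of rank two to the point $(z_0:\dots:z_5)$ of its $2\times 2$ minors with row sets $12,13,14,23,24,34$. Let $\mu\colon\mathbb{C}P^5\to\mathbb{R}^4$, $\mu[z]=\sum_J|z_J|^2\delta_J/\sum_J|z_J|^2$, be the moment map, where $\delta_{J}\in\mathbb R^4$ is the indicator vector of $J$, let $\Delta_{4,2}=\{x\in[0,1]^4:\sum x_i=2\}$ be the octahedron, and let $m$ be its centre. For spaces $X,Y$ the join $X*Y$ is the quotient of $X\times Y\times[0,1]$ by $(x,y,0)\sim(x,y',0)$ and $(x,y,1)\sim(x',y,1)$. Then: (1) $P$ is a topological embedding, its image is the quadric hypersurface $z_0z_5+z_2z_3=z_1z_4$,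 and $P$ is $T^4$-equivariant. (2) $P$ induces a topological embedding of orbit spaces $\iota\colon G_{4,2}/T^4\hookrightarrow\mathbb{C}P^5/T^4$, and $G_{4,2}/T^4$ is homeomorphic to $S^5$. (3) There are an embedding $j\colon\mathbb{C}P^1\hookrightarrow\mathbb{C}P^2$ with $$j(c:1)=(c:1:1-c)\quad(c\in\mathbb{C}),\qquad j(1:0)=(1:0:-1),$$ and homeomorphisms $\theta\colon S^2\cong\partial\Delta_{4,2}$, $h_G\colon G_{4,2}/T^4\cong S^2*\mathbb{C}P^1$ and $h_P\colon\mathbb{C}P^5/T^4\cong S^2*\mathbb{C}P^2$ such that $h_P\circ\iota=(\mathrm{id}_{S^2}*j)\circ h_G$. They can be chosen compatible with the moment maps, that is, for every $W\in G_{4,2}$ (respectively $p\in\mathbb CP^5$) the image under $h_G$ (respectively $h_P$) of its orbit can be written as $[x,y,t]$ with $\mu(P(W))$ (respectively $\mu(p)$) equal to $m+(1-t)(\theta(x)-m)$, and with the parameters of the orbits of the main strata: $h_G$ sends the orbit of the column span of $\begin{pmatrix}1&0\\0&1\\a_5&a_6\\a_7&a_8\end{pmatrix}$ with all $2\times2$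 minors non-zero to a point $[x,(c:1),t]$ with $c=\frac{a_5a_8}{a_6a_7}$, and $h_P$ sends the orbit of $(z_0:\dots:z_5)$ with all $z_i\ne0$ to a point $[x,(c_1:c_2:1),t]$ with $c_1=\frac{z_2z_3}{z_0z_5}$, $c_2=\frac{z_1z_4}{z_0z_5}$. -/

import Mathlib

open scoped LinearAlgebra.Projectivization Pointwise

/-! ### Complex projective spaces -/

/-- The quotient topology of `V ∖ {0} → ℙ V`. -/
noncomputable instance Projectivization.instTopologicalSpaceComplexPi (n : ℕ) :
    TopologicalSpace (ℙ ℂ (Fin n → ℂ)) :=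
  TopologicalSpace.coinduced
    (fun v : {v : Fin n → ℂ // v ≠ 0} => Projectivization.mk ℂ v.1 v.2) inferInstance

/-- `CP n` is the complex projective space `ℂPⁿ` of lines in `ℂⁿ⁺¹`. -/
abbrev CP (n : ℕ) : Type := ℙ ℂ (Fin (n + 1) → ℂ)

/-! ### The compact torus and the pairs indexing the Plücker coordinates -/

/-- The compact torus `Tⁿ`, acting coordinatewise on `ℂⁿ` (Mathlib's pointwise action). -/
abbrev Torus (n : ℕ) : Type := Fin n → Circle

instance (n : ℕ) : SMulCommClass (Torus n) ℂ (Fin n → ℂ) where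
  smul_comm t a v := by
    funext i
    exact smul_comm (t i) a (v i)

/-- The two-element subsets of a four-element set, in the order `12, 13, 14, 23, 24, 34`
(with indices starting at `0`). -/
def pluckerPair : Fin 6 → Fin 4 × Fin 4 :=
  ![(0, 1), (0, 2), (0, 3), (1, 2), (1, 3), (2, 3)]

/-- The homomorphism `T⁴ → T⁶`,
`(t₁,t₂,t₃,t₄) ↦ (t₁t₂, t₁t₃, t₁t₄, t₂t₃, t₂t₄, t₃t₄)`. -/
noncomputable def torusHom : Torus 4 →* Torus 6 where
  toFun t k := t (pluckerPair k).1 * t (pluckerPair k).2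
  map_one' := by funext k; simp
  map_mul' s t := by funext k; simp only [Pi.mul_apply]; exact mul_mul_mul_comm _ _ _ _

/-- `T⁴` acts on `ℂP⁵` through `T⁴ → T⁶` and the standard action of `T⁶` on `ℂP⁵`. -/
noncomputable instance instMulActionTorusCP5 : MulAction (Torus 4) (CP 5) :=
  MulAction.compHom (CP 5) torusHom

/-! ### The Grassmann manifold -/

/-- The set of all two-dimensional complex subspaces of `ℂ⁴`. -/
def Gr42 : Type := {W : Submodule ℂ (Fin 4 → ℂ) // Module.finrank ℂ W = 2}

/-- Two-frames in `ℂ⁴`: the `4 × 2` matrices with linearly independent columns. -/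
abbrev Frame42 : Type := {A : Matrix (Fin 4) (Fin 2) ℂ // LinearIndependent ℂ A.col}

/-- The subspace spanned by the columns of a frame. -/
def colSpan (A : Frame42) : Gr42 :=
  ⟨Submodule.span ℂ (Set.range A.1.col), by
    simpa using finrank_span_eq_card A.2⟩

/-- The topology of the Grassmann manifold, as a quotient of the space of frames. -/
noncomputable instance : TopologicalSpace Gr42 := TopologicalSpace.coinduced colSpan inferInstance

/-- The canonical action of `T⁴` on the Grassmann manifold, `t • W = {t • w | w ∈ W}`. -/
noncomputable instance : MulAction (Torus 4) Gr42 where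
  smul t W := ⟨t • W.1, by
    have h : t • W.1 = W.1.map
        (DistribMulAction.toLinearEquiv ℂ (Fin 4 → ℂ) t : (Fin 4 → ℂ) →ₗ[ℂ] (Fin 4 → ℂ)) := rfl
    rw [h, LinearEquiv.finrank_map_eq]; exact W.2⟩
  one_smul W := Subtype.ext (one_smul _ W.1)
  mul_smul s t W := Subtype.ext (mul_smul s t W.1)

lemma colSpan_surjective : Function.Surjective colSpan := by
  intro W
  let b := Module.finBasisOfFinrankEq ℂ W.1 W.2
  have hcol : (Matrix.of fun i k => (b k : Fin 4 → ℂ) i).col = fun k => (b k : Fin 4 → ℂ) := rfl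
  refine ⟨⟨Matrix.of fun i k => (b k : Fin 4 → ℂ) i, ?_⟩, ?_⟩
  · rw [hcol]
    exact b.linearIndependent.map' W.1.subtype (Submodule.ker_subtype _)
  · apply Subtype.ext
    change Submodule.span ℂ (Set.range (Matrix.of fun i k => (b k : Fin 4 → ℂ) i).col) = W.1
    rw [hcol]
    have h1 : (fun k => (b k : Fin 4 → ℂ)) = W.1.subtype ∘ b := rfl
    rw [h1, Set.range_comp, ← Submodule.map_span, b.span_eq, Submodule.map_top,
      Submodule.range_subtype]

/-! ### The Plücker embedding -/

/-- The vector of all `2 × 2` minors of a `4 × 2` matrix. -/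
def minors (A : Matrix (Fin 4) (Fin 2) ℂ) : Fin 6 → ℂ :=
  fun k => (A.submatrix ![(pluckerPair k).1, (pluckerPair k).2] id).det

lemma minors_apply (A : Matrix (Fin 4) (Fin 2) ℂ) (k : Fin 6) :
    minors A k = A (pluckerPair k).1 0 * A (pluckerPair k).2 1
      - A (pluckerPair k).1 1 * A (pluckerPair k).2 0 := by
  unfold minors
  rw [Matrix.det_fin_two]
  simp

lemma minors_ne_zero (A : Frame42) : minors A.1 ≠ 0 := by
  intro h
  have hk : ∀ k, A.1 (pluckerPair k).1 0 * A.1 (pluckerPair k).2 1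
      - A.1 (pluckerPair k).1 1 * A.1 (pluckerPair k).2 0 = 0 := fun k => by
    rw [← minors_apply, h]; rfl
  have hij : ∀ i j, A.1 i 0 * A.1 j 1 = A.1 i 1 * A.1 j 0 := by
    have h0 := hk 0
    have h1 := hk 1
    have h2 := hk 2
    have h3 := hk 3
    have h4 := hk 4
    have h5 := hk 5
    simp only [pluckerPair, Matrix.cons_val] at h0 h1 h2 h3 h4 h5
    intro i j
    fin_cases i <;> fin_cases j <;> simp only [Fin.zero_eta, Fin.mk_one, Fin.reduceFinMk] <;> grind
  have hli := Fintype.linearIndependent_iff.1 A.2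
  have key : ∀ i, A.1 i 1 = 0 ∧ A.1 i 0 = 0 := fun i => by
    have := hli ![A.1 i 1, -A.1 i 0] (by
      funext j
      simp only [Fin.sum_univ_two, Matrix.cons_val_zero, Matrix.cons_val_one, Pi.add_apply,
        Pi.smul_apply, Matrix.col_apply, smul_eq_mul, Pi.zero_apply]
      linear_combination -hij i j)
    exact ⟨by simpa using this 0, by simpa using this 1⟩
  have := hli ![1, 0] (by
    funext j
    simp [Fin.sum_univ_two, Matrix.col_apply, (key j).2])
  simpa using this 0

lemma mk_minors_congr {A B : Frame42} (h : colSpan B = colSpan A) :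
    Projectivization.mk ℂ (minors B.1) (minors_ne_zero B) =
      Projectivization.mk ℂ (minors A.1) (minors_ne_zero A) := by
  have hs : Submodule.span ℂ (Set.range B.1.col) = Submodule.span ℂ (Set.range A.1.col) :=
    congrArg Subtype.val h
  have hex : ∀ k, ∃ c : Fin 2 → ℂ, ∑ i, c i • A.1.col i = B.1.col k := fun k => by
    have : B.1.col k ∈ Submodule.span ℂ (Set.range A.1.col) :=
      hs ▸ Submodule.subset_span ⟨k, rfl⟩
    exact (Submodule.mem_span_range_iff_exists_fun ℂ).1 this
  choose c hc using hex
  have hent : ∀ i k, B.1 i k = c k 0 * A.1 i 0 + c k 1 * A.1 i 1 := fun i k => by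
    have := congrFun (hc k) i
    simpa [Fin.sum_univ_two, Matrix.col_apply] using this.symm
  rw [Projectivization.mk_eq_mk_iff']
  refine ⟨c 0 0 * c 1 1 - c 0 1 * c 1 0, ?_⟩
  funext k
  simp only [Pi.smul_apply, smul_eq_mul, minors_apply, hent]
  ring

/-- The Plücker map `G₄,₂ → ℂP⁵`: the minors of a matrix whose columns span the subspace. It does
not depend on that matrix, see `plucker_colSpan`. -/
noncomputable def plucker (W : Gr42) : CP 5 :=
  Projectivization.mk ℂ (minors (Function.surjInv colSpan_surjective W).1) (minors_ne_zero _)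

lemma plucker_colSpan (A : Frame42) :
    plucker (colSpan A) = Projectivization.mk ℂ (minors A.1) (minors_ne_zero A) :=
  mk_minors_congr (Function.surjInv_eq colSpan_surjective _)

/-! ### The moment map and the octahedron -/

/-- The vertex `δ_J ∈ ℝ⁴` attached to a two-element subset `J`. -/
def vertex (k : Fin 6) : Fin 4 → ℝ :=
  Pi.single (pluckerPair k).1 1 + Pi.single (pluckerPair k).2 1

/-- The moment map `μ : ℂP⁵ → ℝ⁴`, `μ [z] = (∑ |z_J|² δ_J) / ∑ |z_J|²`. -/
noncomputable def moment : CP 5 → (Fin 4 → ℝ) :=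
  Projectivization.lift
    (fun v => (∑ k, ‖v.1 k‖ ^ 2)⁻¹ • ∑ k, ‖v.1 k‖ ^ 2 • vertex k)
    (by
      intro a b t hab
      have ht : t ≠ 0 := by
        rintro rfl
        exact a.2 (by rw [hab, zero_smul])
      have ht' : ‖t‖ ^ 2 ≠ 0 := by positivity
      have h : ∀ k, ‖a.1 k‖ ^ 2 = ‖t‖ ^ 2 * ‖b.1 k‖ ^ 2 := fun k => by
        rw [hab, Pi.smul_apply, norm_smul, mul_pow]
      funext i
      simp only [h, ← Finset.mul_sum, Pi.smul_apply, Finset.sum_apply, smul_eq_mul, mul_assoc,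
        mul_inv]
      field_simp)

/-- The hypersimplex `Δ₄,₂`, an octahedron. -/
def hypersimplex42 : Set (Fin 4 → ℝ) := {x | (∀ i, 0 ≤ x i ∧ x i ≤ 1) ∧ ∑ i, x i = 2}

/-- The boundary of the octahedron `Δ₄,₂`, the union of its eight facets `x i = 0`, `x i = 1`. -/
def hypersimplex42Boundary : Set (Fin 4 → ℝ) := {x ∈ hypersimplex42 | ∃ i, x i = 0 ∨ x i = 1}

/-- The centre `(1/2, 1/2, 1/2, 1/2)` of the octahedron. -/
noncomputable def hypersimplex42Center : Fin 4 → ℝ := fun _ => 1 / 2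

/-! ### Joins -/

/-- The join relation on `X × Y × [0, 1]`: `(x, y, 0) ∼ (x, y', 0)`, `(x, y, 1) ∼ (x', y, 1)`. -/
def joinSetoid (X Y : Type*) : Setoid (X × Y × unitInterval) where
  r p q := p = q ∨ (p.2.2 = 0 ∧ q.2.2 = 0 ∧ p.1 = q.1) ∨
    (p.2.2 = 1 ∧ q.2.2 = 1 ∧ p.2.1 = q.2.1)
  iseqv :=
    { refl := fun _ => Or.inl rfl
      symm := by
        rintro p q (h | ⟨h1, h2, h3⟩ | ⟨h1, h2, h3⟩)
        · exact Or.inl h.symm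
        · exact Or.inr (Or.inl ⟨h2, h1, h3.symm⟩)
        · exact Or.inr (Or.inr ⟨h2, h1, h3.symm⟩)
      trans := by
        rintro p q r (rfl | ⟨h1, h2, h3⟩ | ⟨h1, h2, h3⟩) (rfl | ⟨k1, k2, k3⟩ | ⟨k1, k2, k3⟩)
        · exact Or.inl rfl
        · exact Or.inr (Or.inl ⟨k1, k2, k3⟩)
        · exact Or.inr (Or.inr ⟨k1, k2, k3⟩)
        · exact Or.inr (Or.inl ⟨h1, h2, h3⟩)
        · exact Or.inr (Or.inl ⟨h1, k2, h3.trans k3⟩)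
        · exact absurd (h2.symm.trans k1) zero_ne_one
        · exact Or.inr (Or.inr ⟨h1, h2, h3⟩)
        · exact absurd (k1.symm.trans h2) zero_ne_one
        · exact Or.inr (Or.inr ⟨h1, k2, h3.trans k3⟩) }

/-- The topological join `X ∗ Y`, with the quotient topology. -/
abbrev Join (X Y : Type*) : Type _ := Quotient (joinSetoid X Y)

/-- The point of `X ∗ Y` given by `(x, y, t)`. -/
def Join.mk {X Y : Type*} (x : X) (y : Y) (t : unitInterval) : Join X Y :=
  Quotient.mk (joinSetoid X Y) (x, y, t)

/-- The map `id ∗ g : X ∗ Y → X ∗ Z`, `[x, y, t] ↦ [x, g y, t]`. -/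
def Join.mapRight {X Y Z : Type*} (g : Y → Z) : Join X Y → Join X Z :=
  Quotient.map (fun p => (p.1, g p.2.1, p.2.2)) (by
    rintro p q (rfl | ⟨h1, h2, h3⟩ | ⟨h1, h2, h3⟩)
    · exact Or.inl rfl
    · exact Or.inr (Or.inl ⟨h1, h2, h3⟩)
    · exact Or.inr (Or.inr ⟨h1, h2, congrArg g h3⟩))

/-! ### Orbit spaces and spheres -/

/-- The orbit space `G₄,₂ / T⁴`. -/
abbrev GrOrbits : Type := Quotient (MulAction.orbitRel (Torus 4) Gr42)

/-- The orbit space `ℂP⁵ / T⁴`. -/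
abbrev CPOrbits : Type := Quotient (MulAction.orbitRel (Torus 4) (CP 5))

/-- The unit sphere `Sⁿ` in Euclidean space. -/
abbrev USphere (n : ℕ) : Type := Metric.sphere (0 : EuclideanSpace ℝ (Fin (n + 1))) 1

/-! Group the coordinates of `z` into the three pairs of opposite vertices of the octahedron, and
let `w = oppProd z = (z₂z₃, z₁z₄, z₀z₅)`. In the coordinates `octCoord` along the diagonals, the
octahedron is the unit ball of the `ℓ¹` norm `octNorm`. For normalised `z` the moment map has
coordinates `a = |u|² - |v|²`, one for each opposite pair `(u, v)`. Since `|u|² + |v|² = √(a² +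
4|uv|²)`, normalisation reads `∑ √(aₖ² + 4|wₖ|²) = 1`.

The left side is strictly increasing in the scale of `w ≠ 0`. So `μ` and the line `[w]` determine
`w` up to a phase, and `T⁴` absorbs both this phase and the phases inside the pairs, because its
image in `T⁶` is the group of all `s` with the same product on every opposite pair
(`exists_torus_smul_of_cpToModel_eq`). Conversely, every point of the octahedron occurs with every
line, by the intermediate value theorem (`exists_cpToModel_eq`). Over the boundary `w = 0` and the
line is lost; at the centre the direction of `μ` is lost. These are the identifications of `S² *
ℂP²`, with `t = 1 - octNorm μ`.

The Plücker quadric is the linear relation `w₂ + w₀ = w₁`, so `G₄,₂` gives the same picture over a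
line `ℂP¹ ⊂ ℂP²`, and `S² * ℂP¹` is `S² * S² = S⁵`.

For the topology, joins and orbit spaces are mapped injectively to one Hausdorff space `JoinModel`
by `(μ, t · projection to the line)`. Compact spaces with equal images there are homeomorphic
(`exists_homeomorph_of_range_eq`), and all compatibilities can be checked in the model. -/

open Topology ComplexConjugate

/-! ### Rank one projections -/

/-- The matrix `v v* / |v|²` of the orthogonal projection to the line spanned by `v`. -/
noncomputable def rankOneProj {n : ℕ} (v : Fin n → ℂ) : Fin n → Fin n → ℂ :=
  fun i j => v i * conj (v j) / ((∑ k, ‖v k‖ ^ 2 : ℝ) : ℂ)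

lemma sum_sq_norm_pos {n : ℕ} {v : Fin n → ℂ} (hv : v ≠ 0) : 0 < ∑ k, ‖v k‖ ^ 2 := by
  obtain ⟨i, hi⟩ := Function.ne_iff.1 hv
  exact Finset.sum_pos' (fun _ _ => by positivity)
    ⟨i, Finset.mem_univ _, by have := norm_pos_iff.2 hi; positivity⟩

lemma sum_sq_norm_smul {n : ℕ} (c : ℂ) (v : Fin n → ℂ) :
    ∑ k, ‖(c • v) k‖ ^ 2 = ‖c‖ ^ 2 * ∑ k, ‖v k‖ ^ 2 := by
  simp [Finset.mul_sum, mul_pow]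

lemma rankOneProj_smul {n : ℕ} {c : ℂ} (hc : c ≠ 0) (v : Fin n → ℂ) :
    rankOneProj (c • v) = rankOneProj v := by
  funext i j
  have hc' : conj c ≠ 0 := (map_ne_zero _).2 hc
  have hs : ((∑ k, ‖(c • v) k‖ ^ 2 : ℝ) : ℂ) = c * conj c * ((∑ k, ‖v k‖ ^ 2 : ℝ) : ℂ) := by
    rw [sum_sq_norm_smul, Complex.ofReal_mul, Complex.ofReal_pow, ← Complex.mul_conj']
  rw [rankOneProj, rankOneProj, hs, Pi.smul_apply, Pi.smul_apply, smul_eq_mul, smul_eq_mul, map_mul,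
    show c * v i * (conj c * conj (v j)) = c * conj c * (v i * conj (v j)) by ring]
  exact mul_div_mul_left _ _ (mul_ne_zero hc hc')

lemma rankOneProj_diag {n : ℕ} (v : Fin n → ℂ) (i : Fin n) :
    rankOneProj v i i = ((‖v i‖ ^ 2 / ∑ k, ‖v k‖ ^ 2 : ℝ) : ℂ) := by
  simp only [rankOneProj, Complex.mul_conj']
  push_cast
  rfl

lemma sum_rankOneProj_diag {n : ℕ} {v : Fin n → ℂ} (hv : v ≠ 0) :
    ∑ i, rankOneProj v i i = 1 := by
  simp only [rankOneProj_diag]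
  rw [← Complex.ofReal_sum, ← Finset.sum_div, div_self (sum_sq_norm_pos hv).ne',
    Complex.ofReal_one]

/-- Column `j` of the projection is a multiple of the vector itself, non-zero when `w j ≠ 0`; the
scalar comes from comparing these columns. That `v ≠ 0` is part of the outcome. -/
lemma exists_eq_smul_of_rankOneProj_eq {n : ℕ} {v w : Fin n → ℂ} (hw : w ≠ 0)
    (h : rankOneProj v = rankOneProj w) : ∃ c : ℂ, c ≠ 0 ∧ v = c • w := by
  obtain ⟨j, hj⟩ := Function.ne_iff.1 hw
  have hW := sum_sq_norm_pos hw
  have hjj := congrFun (congrFun h j) j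
  have hne : rankOneProj w j j ≠ 0 := by
    rw [rankOneProj_diag]
    have : 0 < ‖w j‖ := norm_pos_iff.2 hj
    exact_mod_cast (by positivity)
  have hvj : v j ≠ 0 := by
    intro h0
    rw [← hjj] at hne
    simp [rankOneProj, h0] at hne
  have hV : 0 < ∑ k, ‖v k‖ ^ 2 := sum_sq_norm_pos (fun h0 => hvj (congrFun h0 j))
  have hVc : ((∑ k, ‖v k‖ ^ 2 : ℝ) : ℂ) ≠ 0 := by exact_mod_cast hV.ne'
  have hWc : ((∑ k, ‖w k‖ ^ 2 : ℝ) : ℂ) ≠ 0 := by exact_mod_cast hW.ne'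
  have hvj' : conj (v j) ≠ 0 := (map_ne_zero _).2 hvj
  have hwj' : conj (w j) ≠ 0 := (map_ne_zero _).2 hj
  refine ⟨((∑ k, ‖v k‖ ^ 2 : ℝ) : ℂ) * conj (w j) /
    (((∑ k, ‖w k‖ ^ 2 : ℝ) : ℂ) * conj (v j)), by positivity, ?_⟩
  funext i
  have hij := congrFun (congrFun h i) j
  simp only [rankOneProj] at hij
  rw [div_eq_div_iff hVc hWc] at hij
  rw [Pi.smul_apply, smul_eq_mul]
  field_simp
  linear_combination hij

/-- The bound also covers `v = 0`, where division by zero gives the value `0`. It yields continuity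
of `cpToModel` where the line degenerates. -/
lemma norm_rankOneProj_le_one {n : ℕ} (v : Fin n → ℂ) (i j : Fin n) :
    ‖rankOneProj v i j‖ ≤ 1 := by
  have hle : ∀ i, ‖v i‖ ^ 2 ≤ ∑ k, ‖v k‖ ^ 2 := fun i =>
    Finset.single_le_sum (f := fun k => ‖v k‖ ^ 2) (fun _ _ => by positivity) (Finset.mem_univ i)
  have h0 : 0 ≤ ∑ k, ‖v k‖ ^ 2 := Finset.sum_nonneg fun _ _ => by positivity
  rw [rankOneProj, norm_div, norm_mul, RCLike.norm_conj, Complex.norm_real, Real.norm_of_nonneg h0]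
  refine div_le_one_of_le₀ ?_ h0
  nlinarith [hle i, hle j, sq_nonneg (‖v i‖ - ‖v j‖)]

lemma continuousAt_rankOneProj {n : ℕ} {v : Fin n → ℂ} (hv : v ≠ 0) :
    ContinuousAt (rankOneProj : (Fin n → ℂ) → _) v := by
  refine continuousAt_pi.2 fun i => continuousAt_pi.2 fun j => ?_
  refine ContinuousAt.div (by fun_prop)
    (Continuous.continuousAt (Complex.continuous_ofReal.comp (by fun_prop))) ?_
  exact_mod_cast (sum_sq_norm_pos hv).ne'

/-! ### The topology of complex projective spaces -/

lemma continuous_projectivization_iff {n : ℕ} {X : Type*} [TopologicalSpace X]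
    {f : ℙ ℂ (Fin n → ℂ) → X} : Continuous f ↔
      Continuous fun v : {v : Fin n → ℂ // v ≠ 0} => f (Projectivization.mk ℂ v.1 v.2) :=
  continuous_coinduced_dom

lemma continuous_projectivization_mk (n : ℕ) :
    Continuous fun v : {v : Fin n → ℂ // v ≠ 0} => Projectivization.mk ℂ v.1 v.2 :=
  continuous_coinduced_rng

lemma mk_smul_eq {n : ℕ} {c : ℂ} {v : Fin n → ℂ} (hv : v ≠ 0) (hcv : c • v ≠ 0) :
    Projectivization.mk ℂ (c • v) hcv = Projectivization.mk ℂ v hv :=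
  (Projectivization.mk_eq_mk_iff' ℂ _ _ _ _).2 ⟨c, rfl⟩

/-- The projection to a line, as a function of the line. -/
noncomputable def lineProj {n : ℕ} : ℙ ℂ (Fin n → ℂ) → Fin n → Fin n → ℂ :=
  Projectivization.lift (fun v => rankOneProj v.1) (by
    intro a b t hab
    have ht : t ≠ 0 := by
      rintro rfl
      exact a.2 (by rw [hab, zero_smul])
    rw [hab, rankOneProj_smul ht])

lemma lineProj_mk {n : ℕ} (v : Fin n → ℂ) (hv : v ≠ 0) :
    lineProj (Projectivization.mk ℂ v hv) = rankOneProj v := rfl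

lemma continuous_lineProj {n : ℕ} : Continuous (lineProj : ℙ ℂ (Fin n → ℂ) → _) :=
  continuous_projectivization_iff.2 <| continuous_iff_continuousAt.2 fun v =>
    (continuousAt_rankOneProj v.2).comp (f := Subtype.val) continuousAt_subtype_val

lemma lineProj_injective {n : ℕ} : Function.Injective (lineProj : ℙ ℂ (Fin n → ℂ) → _) := by
  intro p q h
  induction p using Projectivization.ind with | h v hv =>
  induction q using Projectivization.ind with | h w hw =>
  obtain ⟨c, hc, rfl⟩ := exists_eq_smul_of_rankOneProj_eq hw h
  exact mk_smul_eq _ _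

lemma sum_lineProj_diag {n : ℕ} (p : ℙ ℂ (Fin n → ℂ)) : ∑ i, lineProj p i i = 1 := by
  induction p using Projectivization.ind with | h v hv => exact sum_rankOneProj_diag hv

instance (n : ℕ) : T2Space (ℙ ℂ (Fin n → ℂ)) :=
  T2Space.of_injective_continuous lineProj_injective continuous_lineProj

lemma exists_unit_rep {n : ℕ} (p : ℙ ℂ (Fin n → ℂ)) :
    ∃ (v : Fin n → ℂ) (hv : v ≠ 0), ∑ k, ‖v k‖ ^ 2 = 1 ∧ p = Projectivization.mk ℂ v hv := by
  induction p using Projectivization.ind with | h v hv =>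
  have hN := sum_sq_norm_pos hv
  have hc : (((√(∑ k, ‖v k‖ ^ 2))⁻¹ : ℝ) : ℂ) ≠ 0 := by
    exact_mod_cast (inv_pos.2 (Real.sqrt_pos.2 hN)).ne'
  refine ⟨_, smul_ne_zero hc hv, ?_, (mk_smul_eq hv _).symm⟩
  rw [sum_sq_norm_smul, Complex.norm_real, Real.norm_of_nonneg (by positivity), inv_pow,
    Real.sq_sqrt hN.le, inv_mul_cancel₀ hN.ne']

instance (n : ℕ) : CompactSpace (ℙ ℂ (Fin n → ℂ)) := by
  let S : Set (Fin n → ℂ) := {v | ∑ k, ‖v k‖ ^ 2 = 1}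
  have hS : IsCompact S := by
    refine Metric.isCompact_of_isClosed_isBounded
      (isClosed_eq (by fun_prop) continuous_const) ?_
    refine (Metric.isBounded_closedBall (x := (0 : Fin n → ℂ)) (r := 1)).subset fun v hv => ?_
    rw [mem_closedBall_zero_iff, pi_norm_le_iff_of_nonneg zero_le_one]
    intro i
    have h : ‖v i‖ ^ 2 ≤ ∑ k, ‖v k‖ ^ 2 := Finset.single_le_sum
      (f := fun k => ‖v k‖ ^ 2) (fun _ _ => by positivity) (Finset.mem_univ i)
    rw [show ∑ k, ‖v k‖ ^ 2 = 1 from hv] at h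
    nlinarith [norm_nonneg (v i)]
  have h0 : ∀ v ∈ S, v ≠ 0 := by
    rintro v hv rfl
    simp [S] at hv
  have : CompactSpace S := isCompact_iff_compactSpace.1 hS
  have hs : Function.Surjective fun v : S => Projectivization.mk ℂ v.1 (h0 v.1 v.2) := by
    intro p
    obtain ⟨v, hv, h1, rfl⟩ := exists_unit_rep p
    exact ⟨⟨v, h1⟩, rfl⟩
  have hc : Continuous fun v : S => (⟨v.1, h0 v.1 v.2⟩ : {v : Fin n → ℂ // v ≠ 0}) :=
    continuous_subtype_val.subtype_mk _
  exact hs.compactSpace ((continuous_projectivization_mk n).comp hc)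

/-! ### Homeomorphisms from a common continuous image -/

/-- Both maps are closed embeddings, so each source is homeomorphic to the common image. The formula
for `e` is what later transports the moment map and the parameters. -/
lemma exists_homeomorph_of_range_eq {X Y Z : Type*} [TopologicalSpace X] [TopologicalSpace Y]
    [TopologicalSpace Z] [CompactSpace X] [CompactSpace Y] [T2Space Z] {f : X → Z} {g : Y → Z}
    (hf : Continuous f) (hf' : Function.Injective f) (hg : Continuous g)
    (hg' : Function.Injective g) (h : Set.range f = Set.range g) :
    ∃ e : X ≃ₜ Y, ∀ x, g (e x) = f x := by
  have hF := (hf.isClosedEmbedding hf').isEmbedding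
  have hG := (hg.isClosedEmbedding hg').isEmbedding
  refine ⟨(hF.toHomeomorph.trans (Homeomorph.setCongr h)).trans hG.toHomeomorph.symm, fun x => ?_⟩
  have := congrArg Subtype.val
    (hG.toHomeomorph.apply_symm_apply ((Homeomorph.setCongr h) (hF.toHomeomorph x)))
  exact this

/-! ### The octahedron -/

/-- Coordinates centred at the octahedron's centre, along its three diagonals. -/
def octCoord (x : Fin 4 → ℝ) : Fin 3 → ℝ := ![x 0 + x 3 - 1, x 0 + x 2 - 1, x 0 + x 1 - 1]

/-- The point of the hyperplane `∑ x i = 2` with given coordinates along the diagonals. -/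
noncomputable def octPoint (a : Fin 3 → ℝ) : Fin 4 → ℝ :=
  ![1 / 2 + (a 0 + a 1 + a 2) / 2, 1 / 2 + (a 2 - a 0 - a 1) / 2,
    1 / 2 + (a 1 - a 0 - a 2) / 2, 1 / 2 + (a 0 - a 1 - a 2) / 2]

/-- The gauge of the octahedron with respect to its centre. -/
def octNorm (x : Fin 4 → ℝ) : ℝ := ∑ k, |octCoord x k|

lemma octCoord_octPoint (a : Fin 3 → ℝ) : octCoord (octPoint a) = a := by
  funext k
  fin_cases k <;> simp [octCoord, octPoint] <;> ring

lemma sum_octPoint (a : Fin 3 → ℝ) : ∑ i, octPoint a i = 2 := by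
  simp [Fin.sum_univ_four, octPoint]
  ring

lemma eq_of_octCoord_eq {x y : Fin 4 → ℝ} (hx : ∑ i, x i = 2) (hy : ∑ i, y i = 2)
    (h : octCoord x = octCoord y) : x = y := by
  rw [Fin.sum_univ_four] at hx hy
  have h0 := congrFun h 0
  have h1 := congrFun h 1
  have h2 := congrFun h 2
  simp only [octCoord, Matrix.cons_val] at h0 h1 h2
  funext i
  fin_cases i <;> simp only [Fin.zero_eta, Fin.mk_one, Fin.reduceFinMk] <;> linarith

lemma octNorm_nonneg (x : Fin 4 → ℝ) : 0 ≤ octNorm x := Finset.sum_nonneg fun _ _ => abs_nonneg _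

@[fun_prop]
lemma continuous_octNorm : Continuous octNorm := by
  unfold octNorm octCoord
  simp only [Fin.sum_univ_three, Matrix.cons_val]
  fun_prop

lemma sum_hypersimplex42Center : ∑ i, hypersimplex42Center i = 2 := by
  simp [hypersimplex42Center]
  norm_num

lemma octCoord_center_add_smul (x : Fin 4 → ℝ) (s : ℝ) :
    octCoord (hypersimplex42Center + s • (x - hypersimplex42Center)) = s • octCoord x := by
  funext k
  fin_cases k <;> simp [octCoord, hypersimplex42Center] <;> ring

lemma octNorm_center_add_smul (x : Fin 4 → ℝ) {s : ℝ} (hs : 0 ≤ s) :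
    octNorm (hypersimplex42Center + s • (x - hypersimplex42Center)) = s * octNorm x := by
  simp [octNorm, octCoord_center_add_smul, abs_mul, abs_of_nonneg hs, Finset.mul_sum]

lemma sum_center_add_smul {x : Fin 4 → ℝ} (hx : ∑ i, x i = 2) (s : ℝ) :
    ∑ i, (hypersimplex42Center + s • (x - hypersimplex42Center)) i = 2 := by
  simp [Finset.sum_add_distrib, ← Finset.mul_sum, hx, sum_hypersimplex42Center]

/-- On the hyperplane `∑ x i = 2` the eight functions `±(2 x i - 1)` are exactly the sign
combinations `±a₀ ± a₁ ± a₂` of the diagonal coordinates, so facets correspond to sign patterns of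
the `ℓ¹` sphere. -/
lemma mem_hypersimplex42Boundary_iff {x : Fin 4 → ℝ} :
    x ∈ hypersimplex42Boundary ↔ ∑ i, x i = 2 ∧ octNorm x = 1 := by
  simp only [hypersimplex42Boundary, hypersimplex42, Set.mem_ofPred_eq, octNorm, octCoord,
    Fin.sum_univ_four, Fin.sum_univ_three, Matrix.cons_val]
  constructor
  · rintro ⟨⟨hb, hs⟩, hi⟩
    refine ⟨hs, ?_⟩
    have b0 := hb 0
    have b1 := hb 1
    have b2 := hb 2
    have b3 := hb 3
    have hi' : (x 0 = 0 ∨ x 0 = 1) ∨ (x 1 = 0 ∨ x 1 = 1) ∨ (x 2 = 0 ∨ x 2 = 1) ∨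
        (x 3 = 0 ∨ x 3 = 1) := by
      simpa [Fin.exists_fin_succ] using hi
    rcases abs_cases (x 0 + x 3 - 1) with ⟨e0, g0⟩ | ⟨e0, g0⟩ <;>
    rcases abs_cases (x 0 + x 2 - 1) with ⟨e1, g1⟩ | ⟨e1, g1⟩ <;>
    rcases abs_cases (x 0 + x 1 - 1) with ⟨e2, g2⟩ | ⟨e2, g2⟩ <;>
    rw [e0, e1, e2] <;>
    rcases hi' with (h | h) | (h | h) | (h | h) | (h | h) <;> linarith
  · rintro ⟨hs, hn⟩
    have l0 := abs_le.1 (le_refl |x 0 + x 3 - 1|)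
    have l1 := abs_le.1 (le_refl |x 0 + x 2 - 1|)
    have l2 := abs_le.1 (le_refl |x 0 + x 1 - 1|)
    refine ⟨⟨fun i => ?_, hs⟩, ?_⟩
    · fin_cases i <;> simp only [Fin.zero_eta, Fin.mk_one, Fin.reduceFinMk] <;>
        constructor <;> linarith
    · rcases abs_cases (x 0 + x 3 - 1) with ⟨e0, g0⟩ | ⟨e0, g0⟩ <;>
      rcases abs_cases (x 0 + x 2 - 1) with ⟨e1, g1⟩ | ⟨e1, g1⟩ <;>
      rcases abs_cases (x 0 + x 1 - 1) with ⟨e2, g2⟩ | ⟨e2, g2⟩ <;>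
      rw [e0, e1, e2] at hn <;>
      first
      | exact ⟨0, Or.inl (by linarith)⟩
      | exact ⟨0, Or.inr (by linarith)⟩
      | exact ⟨1, Or.inl (by linarith)⟩
      | exact ⟨1, Or.inr (by linarith)⟩
      | exact ⟨2, Or.inl (by linarith)⟩
      | exact ⟨2, Or.inr (by linarith)⟩
      | exact ⟨3, Or.inl (by linarith)⟩
      | exact ⟨3, Or.inr (by linarith)⟩

/-! ### Unit spheres and radial projection onto the boundary of the octahedron. -/

lemma sum_sq_eq_one_of_mem_sphere {n : ℕ} (x : USphere n) : ∑ i, (x.1 i) ^ 2 = 1 := by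
  have h : ‖x.1‖ = 1 := mem_sphere_zero_iff_norm.1 x.2
  rw [← EuclideanSpace.real_norm_sq_eq, h, one_pow]

/-- The unit vector with given coordinates. -/
def spherePoint {n : ℕ} (v : Fin (n + 1) → ℝ) (hv : ∑ i, v i ^ 2 = 1) : USphere n :=
  ⟨WithLp.toLp 2 v, by
    rw [mem_sphere_zero_iff_norm, ← sq_eq_sq₀ (norm_nonneg _) zero_le_one,
      EuclideanSpace.real_norm_sq_eq, one_pow]
    exact hv⟩

lemma spherePoint_apply {n : ℕ} (v : Fin (n + 1) → ℝ) (hv : ∑ i, v i ^ 2 = 1) (i : Fin (n + 1)) :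
    (spherePoint v hv).1 i = v i := rfl

lemma sphere_ext {n : ℕ} {x y : USphere n} (h : ∀ i, x.1 i = y.1 i) : x = y :=
  Subtype.ext (PiLp.ext h)

lemma sum_abs_pos_of_mem_sphere {n : ℕ} (x : USphere n) : 0 < ∑ i, |x.1 i| := by
  have h := sum_sq_eq_one_of_mem_sphere x
  refine lt_of_le_of_ne (Finset.sum_nonneg fun _ _ => abs_nonneg _) fun h0 => ?_
  have hz := (Finset.sum_eq_zero_iff_of_nonneg (fun i _ => abs_nonneg (x.1 i))).1 h0.symm
  have : ∑ i, (x.1 i) ^ 2 = 0 := Finset.sum_eq_zero fun i hi => by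
    rw [abs_eq_zero.1 (hz i hi)]; norm_num
  linarith

lemma exists_spherePoint_smul {n : ℕ} {a : Fin (n + 1) → ℝ} (ha : a ≠ 0) :
    ∃ (x : USphere n) (c : ℝ), 0 < c ∧ ∀ i, a i = c * x.1 i := by
  have hpos : 0 < ∑ i, a i ^ 2 := by
    obtain ⟨i, hi⟩ := Function.ne_iff.1 ha
    exact Finset.sum_pos' (fun _ _ => by positivity)
      ⟨i, Finset.mem_univ _, lt_of_le_of_ne (sq_nonneg _) (pow_ne_zero 2 hi).symm⟩
  have hs := Real.sqrt_pos.2 hpos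
  refine ⟨spherePoint (fun i => a i / √(∑ i, a i ^ 2)) ?_, √(∑ i, a i ^ 2), hs, fun i => ?_⟩
  · simp only [div_pow, Real.sq_sqrt hpos.le, ← Finset.sum_div]
    exact div_self hpos.ne'
  · rw [spherePoint_apply]
    field_simp

lemma nonempty_sphere_homeomorph_boundary :
    Nonempty (USphere 2 ≃ₜ hypersimplex42Boundary) := by
  let f : USphere 2 → (Fin 4 → ℝ) := fun x => octPoint fun i => x.1 i / ∑ k, |x.1 k|
  have hc : Continuous f := by
    have h0 : ∀ x : USphere 2, ∑ k, |x.1 k| ≠ 0 := fun x => (sum_abs_pos_of_mem_sphere x).ne'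
    have h1 : ∀ i, Continuous fun x : USphere 2 => x.1 i / ∑ k, |x.1 k| := fun i =>
      Continuous.div (by fun_prop) (by fun_prop) h0
    have h2 : Continuous octPoint := by
      refine continuous_pi fun i => ?_
      fin_cases i <;> simp only [octPoint, Fin.zero_eta, Fin.mk_one, Fin.reduceFinMk,
        Matrix.cons_val] <;> fun_prop
    exact h2.comp (continuous_pi h1)
  have hi : Function.Injective f := by
    intro x y h
    have hx := sum_abs_pos_of_mem_sphere x
    have hy := sum_abs_pos_of_mem_sphere y
    have h := congrArg octCoord h
    simp only [f, octCoord_octPoint] at h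
    set c := (∑ k, |x.1 k|) / ∑ k, |y.1 k| with hc
    have hcpos : 0 < c := by positivity
    have hxy : ∀ i, x.1 i = c * y.1 i := fun i => by
      have : x.1 i / ∑ k, |x.1 k| = y.1 i / ∑ k, |y.1 k| := congrFun h i
      rw [div_eq_div_iff hx.ne' hy.ne'] at this
      rw [hc]
      field_simp
      linarith
    have h1 := sum_sq_eq_one_of_mem_sphere x
    simp only [hxy, mul_pow, ← Finset.mul_sum, sum_sq_eq_one_of_mem_sphere y] at h1
    have hc1 : c = 1 := by nlinarith
    exact sphere_ext fun i => by rw [hxy, hc1, one_mul]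
  have hr : Set.range f = hypersimplex42Boundary := by
    ext p
    rw [mem_hypersimplex42Boundary_iff]
    constructor
    · rintro ⟨x, rfl⟩
      have hx := sum_abs_pos_of_mem_sphere x
      refine ⟨sum_octPoint _, ?_⟩
      simp only [f, octNorm, octCoord_octPoint, abs_div, ← Finset.sum_div, abs_of_pos hx]
      exact div_self hx.ne'
    · rintro ⟨h2, h1⟩
      have h0 : octCoord p ≠ 0 := fun h => by simp [octNorm, h] at h1
      obtain ⟨x, c, hc, hx⟩ := exists_spherePoint_smul h0
      refine ⟨x, eq_of_octCoord_eq (sum_octPoint _) h2 ?_⟩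
      simp only [octNorm, hx, abs_mul, abs_of_pos hc, ← Finset.mul_sum] at h1
      funext i
      rw [octCoord_octPoint, hx, eq_div_of_mul_eq (sum_abs_pos_of_mem_sphere x).ne' h1,
        one_div, div_eq_inv_mul]
  exact ⟨(hc.isClosedEmbedding hi).isEmbedding.toHomeomorph.trans (Homeomorph.setCongr hr)⟩

lemma exists_boundary_point {p : Fin 4 → ℝ} (hp : ∑ i, p i = 2)
    (θ : USphere 2 ≃ₜ hypersimplex42Boundary) :
    ∃ x, p = hypersimplex42Center +
      octNorm p • ((θ x : Fin 4 → ℝ) - hypersimplex42Center) := by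
  rcases (octNorm_nonneg p).eq_or_lt with h | h
  -- At the centre every direction serves; this one is an arbitrary choice.
  · refine ⟨spherePoint ![1, 0, 0] (by simp [Fin.sum_univ_three]), ?_⟩
    rw [← h, zero_smul, add_zero]
    refine eq_of_octCoord_eq hp sum_hypersimplex42Center ?_
    have h0 := (Finset.sum_eq_zero_iff_of_nonneg (fun i _ => abs_nonneg (octCoord p i))).1 h.symm
    funext k
    rw [abs_eq_zero.1 (h0 k (Finset.mem_univ k))]
    fin_cases k <;> simp [octCoord, hypersimplex42Center] <;> norm_num
  · have hb : hypersimplex42Center + (octNorm p)⁻¹ • (p - hypersimplex42Center) ∈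
        hypersimplex42Boundary := by
      rw [mem_hypersimplex42Boundary_iff, octNorm_center_add_smul _ (by positivity),
        inv_mul_cancel₀ h.ne']
      exact ⟨sum_center_add_smul hp _, rfl⟩
    refine ⟨θ.symm ⟨_, hb⟩, ?_⟩
    rw [Homeomorph.apply_symm_apply, add_sub_cancel_left, smul_inv_smul₀ h.ne', add_sub_cancel]

/-! ### The moment map in pairs of opposite vertices -/

/-- One vertex of each diagonal of the octahedron. -/
def posIdx : Fin 3 → Fin 6 := ![2, 1, 0]

/-- The vertex opposite to `posIdx`. -/
def negIdx : Fin 3 → Fin 6 := ![3, 4, 5]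

/-- The products of opposite coordinates, the monomials of the Plücker relation. -/
def oppProd (z : Fin 6 → ℂ) : Fin 3 → ℂ := fun k => z (posIdx k) * z (negIdx k)

lemma sum_opposite (f : Fin 6 → ℝ) : ∑ J, f J = ∑ k, (f (posIdx k) + f (negIdx k)) := by
  simp [Fin.sum_univ_six, Fin.sum_univ_three, posIdx, negIdx]
  ring

lemma funext_opposite {α : Type*} {f g : Fin 6 → α}
    (h : ∀ k, f (posIdx k) = g (posIdx k) ∧ f (negIdx k) = g (negIdx k)) : f = g := by
  have h0 := h 0
  have h1 := h 1
  have h2 := h 2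
  simp only [posIdx, negIdx, Matrix.cons_val] at h0 h1 h2
  funext J
  fin_cases J
  exacts [h2.1, h1.1, h0.1, h0.2, h1.2, h2.2]

lemma moment_mk (z : Fin 6 → ℂ) (hz : z ≠ 0) :
    moment (Projectivization.mk ℂ z hz) =
      (∑ k, ‖z k‖ ^ 2)⁻¹ • ∑ k, ‖z k‖ ^ 2 • vertex k := rfl

lemma sum_moment (p : CP 5) : ∑ i, moment p i = 2 := by
  induction p using Projectivization.ind with | h z hz =>
  have hN := (sum_sq_norm_pos hz).ne'
  have hv : ∀ k, ∑ i, vertex k i = 2 := fun k => by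
    simp [vertex, Finset.sum_add_distrib]
    norm_num
  simp only [moment_mk, Pi.smul_apply, Finset.sum_apply, smul_eq_mul, ← Finset.mul_sum]
  rw [Finset.sum_comm]
  simp only [← Finset.mul_sum, hv, ← Finset.sum_mul]
  field_simp

lemma octCoord_moment (z : Fin 6 → ℂ) (hz : z ≠ 0) (k : Fin 3) :
    octCoord (moment (Projectivization.mk ℂ z hz)) k =
      (‖z (posIdx k)‖ ^ 2 - ‖z (negIdx k)‖ ^ 2) / ∑ J, ‖z J‖ ^ 2 := by
  have hN := (sum_sq_norm_pos hz).ne'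
  rw [eq_div_iff hN, moment_mk]
  set N := ∑ J, ‖z J‖ ^ 2 with hNdef
  have e : N = ‖z 0‖ ^ 2 + ‖z 1‖ ^ 2 + ‖z 2‖ ^ 2 + ‖z 3‖ ^ 2 + ‖z 4‖ ^ 2 + ‖z 5‖ ^ 2 := by
    rw [hNdef, Fin.sum_univ_six]
  fin_cases k <;>
  · simp [octCoord, vertex, pluckerPair, posIdx, negIdx, Fin.sum_univ_six]
    rw [sub_mul, ← mul_add, mul_comm N⁻¹, mul_assoc, inv_mul_cancel₀ hN, e]
    ring

lemma continuous_moment : Continuous moment := by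
  refine continuous_projectivization_iff.2 ?_
  simp only [moment_mk]
  have h : ∀ k, Continuous fun v : {v : Fin 6 → ℂ // v ≠ 0} => ‖v.1 k‖ ^ 2 := fun k =>
    (((continuous_apply k).comp continuous_subtype_val).norm).pow 2
  exact Continuous.smul (Continuous.inv₀ (continuous_finsetSum _ fun k _ => h k)
      fun v => (sum_sq_norm_pos v.2).ne')
    (continuous_finsetSum _ fun k _ => (h k).smul continuous_const)

/-- The map `(u, v) ↦ (|u|² - |v|², u v)` determines `|u|² + |v|²`. -/
lemma sq_norm_add_sq_norm (u v : ℂ) :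
    ‖u‖ ^ 2 + ‖v‖ ^ 2 = √((‖u‖ ^ 2 - ‖v‖ ^ 2) ^ 2 + 4 * ‖u * v‖ ^ 2) := by
  rw [norm_mul, ← Real.sqrt_sq (show 0 ≤ ‖u‖ ^ 2 + ‖v‖ ^ 2 by positivity)]
  congr 1
  ring

/-- With `s = √(a² + 4|w|²)` the squared norms must be `(s + a) / 2` and `(s - a) / 2`. Here `u` is
taken real and `v` carries the phase of `w`. -/
lemma exists_sq_norm_sub_mul (a : ℝ) (w : ℂ) : ∃ u v : ℂ, u * v = w ∧
    ‖u‖ ^ 2 - ‖v‖ ^ 2 = a ∧ ‖u‖ ^ 2 + ‖v‖ ^ 2 = √(a ^ 2 + 4 * ‖w‖ ^ 2) := by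
  set s := √(a ^ 2 + 4 * ‖w‖ ^ 2) with hs
  have hs2 : s ^ 2 = a ^ 2 + 4 * ‖w‖ ^ 2 := Real.sq_sqrt (by positivity)
  have hsa : |a| ≤ s := Real.le_sqrt_of_sq_le (by rw [sq_abs]; nlinarith [sq_nonneg ‖w‖])
  have h1 : 0 ≤ (s + a) / 2 := by linarith [neg_abs_le a]
  have h2 : 0 ≤ (s - a) / 2 := by linarith [le_abs_self a]
  obtain ⟨e, he, hw⟩ : ∃ e : ℂ, ‖e‖ = 1 ∧ w = ‖w‖ * e := by
    by_cases h : w = 0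
    · exact ⟨1, norm_one, by simp [h]⟩
    · have : (‖w‖ : ℂ) ≠ 0 := by exact_mod_cast norm_ne_zero_iff.2 h
      exact ⟨w / ‖w‖, by simp [h], by field_simp⟩
  have hprod : √((s + a) / 2) * √((s - a) / 2) = ‖w‖ := by
    rw [← Real.sqrt_mul h1, ← Real.sqrt_sq (norm_nonneg w)]
    congr 1
    nlinarith
  have e1 : ‖(√((s + a) / 2) : ℂ)‖ ^ 2 = (s + a) / 2 := by
    rw [Complex.norm_real, Real.norm_of_nonneg (Real.sqrt_nonneg _), Real.sq_sqrt h1]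
  have e2 : ‖(√((s - a) / 2) : ℂ) * e‖ ^ 2 = (s - a) / 2 := by
    rw [norm_mul, he, mul_one, Complex.norm_real, Real.norm_of_nonneg (Real.sqrt_nonneg _),
      Real.sq_sqrt h2]
  refine ⟨(√((s + a) / 2) : ℂ), (√((s - a) / 2) : ℂ) * e, ?_, ?_, ?_⟩
  · conv_rhs => rw [hw, ← hprod]
    push_cast
    ring
  · rw [e1, e2]; ring
  · rw [e1, e2]; ring

/-- The difference of squared norms and the norm of the product fix both norms, so only phases can
differ. If one coordinate vanishes, its phase is free and is used to obtain `α * β = c`. -/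
lemma exists_circle_mul {u v u' v' : ℂ} {c : Circle}
    (ha : ‖u'‖ ^ 2 - ‖v'‖ ^ 2 = ‖u‖ ^ 2 - ‖v‖ ^ 2) (hw : u' * v' = c * (u * v)) :
    ∃ α β : Circle, α * β = c ∧ u' = α * u ∧ v' = β * v := by
  have hs : ‖u'‖ ^ 2 + ‖v'‖ ^ 2 = ‖u‖ ^ 2 + ‖v‖ ^ 2 := by
    rw [sq_norm_add_sq_norm, sq_norm_add_sq_norm u, ha, hw, norm_mul, Circle.norm_coe, one_mul]
  have hu : ‖u'‖ = ‖u‖ := (sq_eq_sq₀ (norm_nonneg _) (norm_nonneg _)).1 (by linarith)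
  have hv : ‖v'‖ = ‖v‖ := (sq_eq_sq₀ (norm_nonneg _) (norm_nonneg _)).1 (by linarith)
  have key : ∀ {x x' : ℂ}, ‖x'‖ = ‖x‖ → x ≠ 0 → ∃ α : Circle, x' = α * x := fun {x x'} h hx =>
    ⟨⟨x' / x, mem_sphere_zero_iff_norm.2 (by rw [norm_div, h, div_self (norm_ne_zero_iff.2 hx)])⟩,
      (div_mul_cancel₀ x' hx).symm⟩
  by_cases hu0 : u = 0
  · have hu0' : u' = 0 := by rw [hu0, norm_zero, norm_eq_zero] at hu; exact hu
    by_cases hv0 : v = 0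
    · have hv0' : v' = 0 := by rw [hv0, norm_zero, norm_eq_zero] at hv; exact hv
      exact ⟨c, 1, mul_one c, by simp [hu0, hu0'], by simp [hv0, hv0']⟩
    · obtain ⟨β, hβ⟩ := key hv hv0
      exact ⟨c * β⁻¹, β, by simp, by simp [hu0, hu0'], hβ⟩
  · obtain ⟨α, hα⟩ := key hu hu0
    refine ⟨α, α⁻¹ * c, by simp, hα, ?_⟩
    have h0 : (α : ℂ) ≠ 0 := Circle.coe_ne_zero α
    rw [hα] at hw
    rw [Circle.coe_mul, Circle.coe_inv]
    apply mul_left_cancel₀ (mul_ne_zero h0 hu0)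
    rw [hw]
    field_simp

/-- Termwise `||u|² - |v|²| ≤ |u|² + |v|²`, with equality exactly when `u v = 0`. -/
lemma octNorm_moment_le_one_and (z : Fin 6 → ℂ) (hz : z ≠ 0) :
    octNorm (moment (Projectivization.mk ℂ z hz)) ≤ 1 ∧
      (octNorm (moment (Projectivization.mk ℂ z hz)) = 1 ↔ oppProd z = 0) := by
  have hN := sum_sq_norm_pos hz
  have hk : ∀ k ∈ Finset.univ, |‖z (posIdx k)‖ ^ 2 - ‖z (negIdx k)‖ ^ 2| ≤
      ‖z (posIdx k)‖ ^ 2 + ‖z (negIdx k)‖ ^ 2 := fun k _ => by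
    rw [abs_le]
    constructor <;> nlinarith [sq_nonneg ‖z (posIdx k)‖, sq_nonneg ‖z (negIdx k)‖]
  have he : octNorm (moment (Projectivization.mk ℂ z hz)) =
      (∑ k, |‖z (posIdx k)‖ ^ 2 - ‖z (negIdx k)‖ ^ 2|) / ∑ J, ‖z J‖ ^ 2 := by
    simp only [octNorm, octCoord_moment, abs_div, abs_of_pos hN, ← Finset.sum_div]
  rw [he]
  constructor
  · rw [div_le_one hN, sum_opposite]
    exact Finset.sum_le_sum hk
  · rw [div_eq_one_iff_eq hN.ne', sum_opposite, Finset.sum_eq_sum_iff_of_le hk, funext_iff]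
    refine forall_congr' fun k => ?_
    simp only [Finset.mem_univ, true_imp_iff, oppProd, Pi.zero_apply, mul_eq_zero]
    constructor
    · intro h
      rcases abs_cases (‖z (posIdx k)‖ ^ 2 - ‖z (negIdx k)‖ ^ 2) with ⟨e, -⟩ | ⟨e, -⟩
      · exact Or.inr (norm_eq_zero.1 (pow_eq_zero_iff two_ne_zero |>.1 (by linarith)))
      · exact Or.inl (norm_eq_zero.1 (pow_eq_zero_iff two_ne_zero |>.1 (by linarith)))
    · rintro (h | h) <;> simp [h]

/-! ### The action of the torus -/

lemma exists_circle_sq (c : Circle) : ∃ t : Circle, t * t = c :=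
  ⟨Circle.exp (Complex.arg c / 2), by rw [← Circle.exp_add, add_halves, Circle.exp_arg]⟩

lemma exists_torusHom_eq {s : Torus 6} {c : Circle} (h : ∀ k, s (posIdx k) * s (negIdx k) = c) :
    ∃ t, torusHom t = s := by
  have h0 : s 2 * s 3 = c := h 0
  have h1 : s 1 * s 4 = c := h 1
  have h2 : s 0 * s 5 = c := h 2
  -- A preimage has `t₁² = (t₁t₂)(t₁t₃)/(t₂t₃)`; after this square root the other entries are forced
  -- by `s 0`, `s 1`, `s 2`.
  obtain ⟨t, ht⟩ := exists_circle_sq (s 0 * s 1 / s 3)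
  have e3 : s 3 = s 0 * s 1 / (t * t) := by rw [ht, div_div_cancel]
  have e2 : s 2 = c / s 3 := eq_div_of_mul_eq' h0
  have e4 : s 4 = c / s 1 := eq_div_of_mul_eq'' h1
  have e5 : s 5 = c / s 0 := eq_div_of_mul_eq'' h2
  refine ⟨![t, s 0 / t, s 1 / t, s 2 / t], ?_⟩
  funext J
  fin_cases J <;> simp [torusHom, pluckerPair]
  · rw [e3]
    simp [div_eq_mul_inv, mul_comm, mul_left_comm, mul_assoc]
  · rw [e4, e2, e3]
    simp [div_eq_mul_inv, mul_comm, mul_left_comm, mul_assoc]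
  · rw [e5, e2, e3]
    simp [div_eq_mul_inv, mul_comm, mul_left_comm, mul_assoc]

lemma torus_smul_mk (t : Torus 4) (z : Fin 6 → ℂ) (hz : z ≠ 0) :
    t • Projectivization.mk ℂ z hz = Projectivization.mk ℂ (torusHom t • z)
      ((smul_ne_zero_iff_ne _).2 hz) := rfl

lemma torusHom_opposite (t : Torus 4) (k : Fin 3) :
    torusHom t (posIdx k) * torusHom t (negIdx k) = t 0 * t 1 * t 2 * t 3 := by
  fin_cases k <;> simp [torusHom, pluckerPair, posIdx, negIdx, mul_comm, mul_left_comm, mul_assoc]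

lemma oppProd_torus_smul (t : Torus 4) (z : Fin 6 → ℂ) :
    oppProd (torusHom t • z) = ((t 0 * t 1 * t 2 * t 3 : Circle) : ℂ) • oppProd z := by
  funext k
  simp only [oppProd, Pi.smul_apply', Circle.smul_def, smul_eq_mul, Pi.smul_apply,
    ← torusHom_opposite t k, Circle.coe_mul]
  ring

lemma moment_torus_smul (t : Torus 4) (p : CP 5) : moment (t • p) = moment p := by
  induction p using Projectivization.ind with | h z hz =>
  have h : ∀ J, ‖(torusHom t • z) J‖ = ‖z J‖ := fun J => by
    rw [Pi.smul_apply', Circle.smul_def, norm_smul, Circle.norm_coe, one_mul]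
  rw [torus_smul_mk, moment_mk, moment_mk]
  simp only [h]

/-! ### A common model of joins and orbit spaces -/

/-- The space in which the join and the orbit space of `ℂP⁵` have a common image. -/
abbrev JoinModel : Type := (Fin 4 → ℝ) × (Fin 3 → Fin 3 → ℂ)

/-- The map of a join of `S²` to the model. -/
noncomputable def joinToModel {Y : Type*} (θ : USphere 2 ≃ₜ hypersimplex42Boundary)
    (g : Y → Fin 3 → Fin 3 → ℂ) : Join (USphere 2) Y → JoinModel :=
  Quotient.lift (fun q => (hypersimplex42Center +
      (1 - (q.2.2 : ℝ)) • ((θ q.1 : Fin 4 → ℝ) - hypersimplex42Center), (q.2.2 : ℝ) • g q.2.1)) (by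
    rintro ⟨x, y, t⟩ ⟨x', y', t'⟩ (h | ⟨h1, h2, h3⟩ | ⟨h1, h2, h3⟩)
    · rw [h]
    · simp only at h1 h2 h3
      simp [h1, h2, h3]
    · simp only at h1 h2 h3
      simp [h1, h2, h3])

lemma joinToModel_mk {Y : Type*} (θ : USphere 2 ≃ₜ hypersimplex42Boundary)
    (g : Y → Fin 3 → Fin 3 → ℂ) (x : USphere 2) (y : Y) (t : unitInterval) :
    joinToModel θ g (Join.mk x y t) = (hypersimplex42Center +
      (1 - (t : ℝ)) • ((θ x : Fin 4 → ℝ) - hypersimplex42Center), (t : ℝ) • g y) := rfl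

lemma Join.exists_mk {X Y : Type*} (q : Join X Y) : ∃ x y t, q = Join.mk x y t := by
  induction q using Quotient.ind with | _ p => exact ⟨p.1, p.2.1, p.2.2, rfl⟩

lemma Join.mk_eq_mk_zero {X Y : Type*} (x : X) (y y' : Y) : Join.mk x y 0 = Join.mk x y' 0 :=
  Quotient.sound (Or.inr (Or.inl ⟨rfl, rfl, rfl⟩))

lemma Join.mk_eq_mk_one {X Y : Type*} (x x' : X) (y : Y) : Join.mk x y 1 = Join.mk x' y 1 :=
  Quotient.sound (Or.inr (Or.inr ⟨rfl, rfl, rfl⟩))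

lemma joinToModel_mapRight {Y Z : Type*} (θ : USphere 2 ≃ₜ hypersimplex42Boundary)
    (g : Z → Fin 3 → Fin 3 → ℂ) (f : Y → Z) (q : Join (USphere 2) Y) :
    joinToModel θ g (Join.mapRight f q) = joinToModel θ (g ∘ f) q := by
  obtain ⟨x, y, t, rfl⟩ := q.exists_mk
  rfl

lemma continuous_joinToModel {Y : Type*} [TopologicalSpace Y]
    (θ : USphere 2 ≃ₜ hypersimplex42Boundary) {g : Y → Fin 3 → Fin 3 → ℂ} (hg : Continuous g) :
    Continuous (joinToModel θ g) := by
  refine Continuous.quotient_lift ?_ _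
  have := θ.continuous
  fun_prop

lemma joinToModel_injective {Y : Type*} (θ : USphere 2 ≃ₜ hypersimplex42Boundary)
    {g : Y → Fin 3 → Fin 3 → ℂ} (hg : Function.Injective g) (htr : ∀ y, ∑ i, g y i i = 1) :
    Function.Injective (joinToModel θ g) := by
  intro p q h
  obtain ⟨x, y, t, rfl⟩ := p.exists_mk
  obtain ⟨x', y', t', rfl⟩ := q.exists_mk
  simp only [joinToModel_mk, Prod.mk.injEq] at h
  obtain ⟨h1, h2⟩ := h
  -- Projections to lines have trace one, so the trace of the second component recovers `t`.
  have htt : t = t' := by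
    have htr' : ∀ (s : ℝ) (y : Y), ∑ i, (s • g y) i i = s := fun s y => by
      simp only [Pi.smul_apply]
      rw [← Finset.smul_sum, htr, Complex.real_smul, mul_one]
    have := congrArg (fun A : Fin 3 → Fin 3 → ℂ => ∑ i, A i i) h2
    simp only [htr'] at this
    exact Subtype.ext (by exact_mod_cast this)
  subst htt
  have hx : t ≠ 1 → x = x' := fun ht => by
    have ht' : (1 - (t : ℝ)) ≠ 0 := sub_ne_zero.2 fun h => ht (Subtype.ext h.symm)
    have := smul_right_injective _ ht' (add_left_cancel h1)
    exact θ.injective (Subtype.ext (sub_left_injective this))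
  have hy : t ≠ 0 → y = y' := fun ht =>
    hg (smul_right_injective _ (fun h => ht (Subtype.ext h)) h2)
  by_cases h0 : t = 0
  · rw [hx (by rw [h0]; exact zero_ne_one), h0]
    exact Join.mk_eq_mk_zero _ _ _
  · rw [hy h0]
    by_cases h1 : t = 1
    · rw [h1]
      exact Join.mk_eq_mk_one _ _ _
    · rw [hx h1]

/-- The map of `ℂP⁵` to the model: the moment map, and the projection to the line spanned by
the products of opposite coordinates, scaled by the distance to the boundary. -/
noncomputable def cpToModel (p : CP 5) : JoinModel :=
  (moment p, (1 - octNorm (moment p)) • Projectivization.lift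
    (fun v : {v : Fin 6 → ℂ // v ≠ 0} => rankOneProj (oppProd v.1)) (by
      intro a b t hab
      have ht : t ≠ 0 := by
        rintro rfl
        exact a.2 (by rw [hab, zero_smul])
      have : oppProd a.1 = (t * t) • oppProd b.1 := by
        funext k
        simp only [hab, oppProd, Pi.smul_apply, smul_eq_mul]
        ring
      rw [this, rankOneProj_smul (mul_ne_zero ht ht)]) p)

lemma cpToModel_mk (z : Fin 6 → ℂ) (hz : z ≠ 0) :
    cpToModel (Projectivization.mk ℂ z hz) = (moment (Projectivization.mk ℂ z hz),
      (1 - octNorm (moment (Projectivization.mk ℂ z hz))) • rankOneProj (oppProd z)) := rfl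

lemma continuous_cpToModel : Continuous cpToModel := by
  refine continuous_moment.prodMk (continuous_projectivization_iff.2 ?_)
  have hm : Continuous fun v : {v : Fin 6 → ℂ // v ≠ 0} =>
      1 - octNorm (moment (Projectivization.mk ℂ v.1 v.2)) :=
    continuous_const.sub (continuous_octNorm.comp
      (continuous_projectivization_iff.1 continuous_moment))
  have hq : Continuous fun v : {v : Fin 6 → ℂ // v ≠ 0} => oppProd v.1 := by
    unfold oppProd
    exact continuous_pi fun k => ((continuous_apply _).comp continuous_subtype_val).mul
      ((continuous_apply _).comp continuous_subtype_val)
  refine continuous_iff_continuousAt.2 fun v => ?_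
  simp only [Projectivization.lift_mk]
  by_cases hv : oppProd v.1 = 0
  -- `rankOneProj` is discontinuous at `0`, but it is bounded and its factor vanishes there.
  · have h0 : 1 - octNorm (moment (Projectivization.mk ℂ v.1 v.2)) = 0 :=
      sub_eq_zero.2 ((octNorm_moment_le_one_and v.1 v.2).2.2 hv).symm
    rw [ContinuousAt, h0, zero_smul]
    refine squeeze_zero_norm
      (a := fun v => ‖1 - octNorm (moment (Projectivization.mk ℂ v.1 v.2))‖) (fun w => ?_) ?_
    · rw [norm_smul]
      refine mul_le_of_le_one_right (norm_nonneg _) ?_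
      exact (pi_norm_le_iff_of_nonneg zero_le_one).2 fun i =>
        (pi_norm_le_iff_of_nonneg zero_le_one).2 fun j => norm_rankOneProj_le_one _ i j
    · have := hm.norm.tendsto v
      rwa [h0, norm_zero] at this
  · exact hm.continuousAt.smul (ContinuousAt.comp (f := fun v : {v : Fin 6 → ℂ // v ≠ 0} =>
      oppProd v.1) (continuousAt_rankOneProj hv) hq.continuousAt)

lemma cpToModel_torus_smul (t : Torus 4) (p : CP 5) : cpToModel (t • p) = cpToModel p := by
  induction p using Projectivization.ind with | h z hz =>
  have hm := moment_torus_smul t (Projectivization.mk ℂ z hz)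
  rw [torus_smul_mk] at hm ⊢
  rw [cpToModel_mk, cpToModel_mk, hm, oppProd_torus_smul, rankOneProj_smul (Circle.coe_ne_zero _)]

lemma sum_sqrt_eq_one {z : Fin 6 → ℂ} (hz : z ≠ 0) (h1 : ∑ J, ‖z J‖ ^ 2 = 1) :
    ∑ k, √(octCoord (moment (Projectivization.mk ℂ z hz)) k ^ 2 + 4 * ‖oppProd z k‖ ^ 2) = 1 := by
  rw [← h1, sum_opposite]
  refine Finset.sum_congr rfl fun k _ => ?_
  rw [octCoord_moment, h1, div_one, sq_norm_add_sq_norm, oppProd]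

/-- The model separates orbits. Equal lines give `oppProd z = c • oppProd z'`; for unit
representatives `‖c‖ ≠ 1` would contradict strict monotonicity of `∑ √(aₖ² + 4|wₖ|²)`. The pairs are
then matched by phases with common product `c`. -/
lemma exists_torus_smul_of_cpToModel_eq {p p' : CP 5} (h : cpToModel p = cpToModel p') :
    ∃ t : Torus 4, t • p' = p := by
  obtain ⟨z, hz, h1, rfl⟩ := exists_unit_rep p
  obtain ⟨z', hz', h1', rfl⟩ := exists_unit_rep p'
  rw [cpToModel_mk, cpToModel_mk, Prod.mk.injEq] at h
  obtain ⟨hm, hK⟩ := h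
  have ha : ∀ k, ‖z (posIdx k)‖ ^ 2 - ‖z (negIdx k)‖ ^ 2 =
      ‖z' (posIdx k)‖ ^ 2 - ‖z' (negIdx k)‖ ^ 2 := fun k => by
    have := congrFun (congrArg octCoord hm) k
    simpa only [octCoord_moment, h1, h1', div_one] using this
  have hq : ∃ c : Circle, oppProd z = (c : ℂ) • oppProd z' := by
    by_cases h0 : oppProd z' = 0
    · refine ⟨1, ?_⟩
      rw [h0, smul_zero, ← (octNorm_moment_le_one_and z hz).2, hm]
      exact (octNorm_moment_le_one_and z' hz').2.2 h0
    · have hn : 1 - octNorm (moment (Projectivization.mk ℂ z' hz')) ≠ 0 := fun h =>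
        h0 ((octNorm_moment_le_one_and z' hz').2.1 (sub_eq_zero.1 h).symm)
      rw [hm] at hK
      obtain ⟨c, hc, hcz⟩ := exists_eq_smul_of_rankOneProj_eq h0 (smul_right_injective _ hn hK)
      suffices hc1 : ‖c‖ = 1 from ⟨⟨c, mem_sphere_zero_iff_norm.2 hc1⟩, hcz⟩
      have e := sum_sqrt_eq_one hz h1
      have e' := sum_sqrt_eq_one hz' h1'
      rw [hm, hcz] at e
      set a := octCoord (moment (Projectivization.mk ℂ z' hz'))
      obtain ⟨k, hk⟩ := Function.ne_iff.1 h0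
      have hk : 0 < ‖oppProd z' k‖ := norm_pos_iff.2 hk
      have hsq : ∀ k, ‖(c • oppProd z') k‖ ^ 2 = ‖c‖ ^ 2 * ‖oppProd z' k‖ ^ 2 := fun k => by
        rw [Pi.smul_apply, norm_smul, mul_pow]
      simp only [hsq] at e
      have hc0 := norm_nonneg c
      rcases lt_trichotomy ‖c‖ 1 with hlt | heq | hgt
      · have hc2 : ‖c‖ ^ 2 < 1 := by nlinarith
        refine absurd (e.trans e'.symm) (ne_of_lt (Finset.sum_lt_sum (fun i _ => ?_)
          ⟨k, Finset.mem_univ _, ?_⟩))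
        · exact Real.sqrt_le_sqrt (by nlinarith [sq_nonneg ‖oppProd z' i‖])
        · exact Real.sqrt_lt_sqrt (by positivity) (by nlinarith [pow_pos hk 2])
      · exact heq
      · have hc2 : 1 < ‖c‖ ^ 2 := by nlinarith
        refine absurd (e'.trans e.symm) (ne_of_lt (Finset.sum_lt_sum (fun i _ => ?_)
          ⟨k, Finset.mem_univ _, ?_⟩))
        · exact Real.sqrt_le_sqrt (by nlinarith [sq_nonneg ‖oppProd z' i‖])
        · exact Real.sqrt_lt_sqrt (by positivity) (by nlinarith [pow_pos hk 2])
  obtain ⟨c, hc⟩ := hq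
  choose α β hαβ hα hβ using fun k => exists_circle_mul (ha k) (congrFun hc k)
  -- The order inverts `posIdx = (2, 1, 0)` and `negIdx = (3, 4, 5)`.
  let s : Torus 6 := ![α 2, α 1, α 0, β 0, β 1, β 2]
  have hsα : ∀ k, s (posIdx k) = α k := fun k => by fin_cases k <;> rfl
  have hsβ : ∀ k, s (negIdx k) = β k := fun k => by fin_cases k <;> rfl
  obtain ⟨t, ht⟩ := exists_torusHom_eq (s := s) (c := c) fun k => by rw [hsα, hsβ, hαβ]
  refine ⟨t, ?_⟩
  rw [torus_smul_mk]
  congr 1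
  rw [ht]
  refine funext_opposite fun k => ?_
  simp only [Pi.smul_apply', Circle.smul_def, smul_eq_mul, hsα, hsβ]
  exact ⟨(hα k).symm, (hβ k).symm⟩

/-! ### Points of the join as images -/

/-- Over the boundary `t = 0`, so `y` may be arbitrary there. Besides one inclusion of images, this
gives the parameters of the main strata. -/
lemma exists_joinToModel_eq {Y : Type*} (θ : USphere 2 ≃ₜ hypersimplex42Boundary)
    (g : Y → Fin 3 → Fin 3 → ℂ) (z : Fin 6 → ℂ) (hz : z ≠ 0) (y : Y)
    (hy : oppProd z ≠ 0 → rankOneProj (oppProd z) = g y) :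
    ∃ x t, cpToModel (Projectivization.mk ℂ z hz) = joinToModel θ g (Join.mk x y t) := by
  obtain ⟨hle, hiff⟩ := octNorm_moment_le_one_and z hz
  obtain ⟨x, hx⟩ := exists_boundary_point (sum_moment (Projectivization.mk ℂ z hz)) θ
  obtain ⟨t, ht⟩ : ∃ t : unitInterval, (t : ℝ) = 1 - octNorm (moment (Projectivization.mk ℂ z hz)) :=
    ⟨⟨_, sub_nonneg.2 hle, sub_le_self _ (octNorm_nonneg _)⟩, rfl⟩
  refine ⟨x, t, ?_⟩
  rw [cpToModel_mk, joinToModel_mk, Prod.mk.injEq, ht, sub_sub_cancel]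
  refine ⟨hx, ?_⟩
  by_cases h0 : oppProd z = 0
  · rw [hiff.2 h0, sub_self, zero_smul, zero_smul]
  · rw [hy h0]

lemma exists_sum_sqrt_eq_one {a : Fin 3 → ℝ} (ha : ∑ k, |a k| ≤ 1) {w : Fin 3 → ℂ} (hw : w ≠ 0) :
    ∃ r : ℝ, ∑ k, √(a k ^ 2 + 4 * ‖((r : ℂ) • w) k‖ ^ 2) = 1 := by
  obtain ⟨j, hj⟩ := Function.ne_iff.1 hw
  have hj : 0 < ‖w j‖ := norm_pos_iff.2 hj
  have hcont : Continuous fun r : ℝ => ∑ k, √(a k ^ 2 + 4 * ‖((r : ℂ) • w) k‖ ^ 2) := by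
    simp only [Pi.smul_apply]
    fun_prop
  have h0 : ∑ k, √(a k ^ 2 + 4 * ‖(((0 : ℝ) : ℂ) • w) k‖ ^ 2) ≤ 1 := by
    simpa [Real.sqrt_sq_eq_abs] using ha
  -- The endpoint `1 / (2 ‖w j‖)` makes `4‖r w j‖² = 1`, so the single summand `j` is already at
  -- least `1`.
  have h1 : 1 ≤ ∑ k, √(a k ^ 2 + 4 * ‖(((1 / (2 * ‖w j‖) : ℝ) : ℂ) • w) k‖ ^ 2) := by
    refine le_trans ?_ (Finset.single_le_sum (fun i _ => Real.sqrt_nonneg _) (Finset.mem_univ j))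
    refine Real.le_sqrt_of_sq_le ?_
    rw [Pi.smul_apply, norm_smul, Complex.norm_real, Real.norm_of_nonneg (by positivity)]
    have : 1 / (2 * ‖w j‖) * ‖w j‖ = 1 / 2 := by field_simp
    rw [this]
    nlinarith [sq_nonneg (a j)]
  obtain ⟨r, -, hr⟩ := intermediate_value_Icc (by positivity) hcont.continuousOn ⟨h0, h1⟩
  exact ⟨r, hr⟩

/-- Scaling `w` to satisfy the normalisation and solving each opposite pair separately yields a unit
vector `z`. The relation `oppProd z = r • w` is kept because it shows that `z` lies on the quadric
when `w` lies on the Plücker line. -/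
lemma exists_cpToModel_eq {Y : Type*} (θ : USphere 2 ≃ₜ hypersimplex42Boundary)
    (g : Y → Fin 3 → Fin 3 → ℂ) (x : USphere 2) (y : Y) (t : unitInterval) {w : Fin 3 → ℂ}
    (hw : w ≠ 0) (hy : g y = rankOneProj w) :
    ∃ (z : Fin 6 → ℂ) (hz : z ≠ 0) (r : ℂ), oppProd z = r • w ∧
      cpToModel (Projectivization.mk ℂ z hz) = joinToModel θ g (Join.mk x y t) := by
  obtain ⟨hθs, hθn⟩ := mem_hypersimplex42Boundary_iff.1 (θ x).2
  set m : Fin 4 → ℝ := hypersimplex42Center +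
    (1 - (t : ℝ)) • ((θ x : Fin 4 → ℝ) - hypersimplex42Center) with hm
  have hmn : octNorm m = 1 - t := by
    rw [hm, octNorm_center_add_smul _ (sub_nonneg.2 t.2.2), hθn, mul_one]
  have hms : ∑ i, m i = 2 := sum_center_add_smul hθs _
  obtain ⟨r, hr⟩ := exists_sum_sqrt_eq_one (a := octCoord m)
    (hmn.le.trans (by linarith [t.2.1])) hw
  choose u v huv ha hs using fun k => exists_sq_norm_sub_mul (octCoord m k) (((r : ℂ) • w) k)
  let z : Fin 6 → ℂ := ![u 2, u 1, u 0, v 0, v 1, v 2]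
  have hzu : ∀ k, z (posIdx k) = u k := fun k => by fin_cases k <;> rfl
  have hzv : ∀ k, z (negIdx k) = v k := fun k => by fin_cases k <;> rfl
  have h1 : ∑ J, ‖z J‖ ^ 2 = 1 := by
    rw [sum_opposite (fun J => ‖z J‖ ^ 2)]
    simp only [hzu, hzv, hs, hr]
  have hz : z ≠ 0 := fun h => by simp [h] at h1
  have hq : oppProd z = (r : ℂ) • w := funext fun k => by rw [oppProd, hzu, hzv, huv]
  have hmz : moment (Projectivization.mk ℂ z hz) = m := by
    refine eq_of_octCoord_eq (sum_moment _) hms (funext fun k => ?_)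
    rw [octCoord_moment, h1, div_one, hzu, hzv, ha]
  refine ⟨z, hz, r, hq, ?_⟩
  rw [cpToModel_mk, joinToModel_mk, hmz, hmn, sub_sub_cancel, Prod.mk.injEq, hy]
  refine ⟨rfl, ?_⟩
  -- If `r = 0` the point lies over the boundary, so `t = 0` and both scaled projections vanish.
  by_cases hr0 : (r : ℂ) = 0
  · have h := (octNorm_moment_le_one_and z hz).2.2 (by rw [hq, hr0, zero_smul])
    rw [hmz, hmn, sub_eq_self] at h
    rw [h, zero_smul, zero_smul]
  · rw [hq, rankOneProj_smul hr0]

/-! ### The Plücker map -/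

lemma linearIndependent_col_of_minors_ne_zero {A : Matrix (Fin 4) (Fin 2) ℂ} (h : minors A ≠ 0) :
    LinearIndependent ℂ A.col := by
  obtain ⟨K, hK⟩ := Function.ne_iff.1 h
  rw [minors_apply, Pi.zero_apply] at hK
  refine Fintype.linearIndependent_iff.2 fun g hg => ?_
  have hr : ∀ i, g 0 * A i 0 + g 1 * A i 1 = 0 := fun i => by
    simpa [Fin.sum_univ_two, Matrix.col_apply] using congrFun hg i
  have h1 := hr (pluckerPair K).1
  have h2 := hr (pluckerPair K).2
  rw [Fin.forall_fin_two]
  constructor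
  · apply (mul_eq_zero.1 _).resolve_right hK
    linear_combination A (pluckerPair K).2 1 * h1 - A (pluckerPair K).1 1 * h2
  · apply (mul_eq_zero.1 _).resolve_right hK
    linear_combination A (pluckerPair K).1 0 * h2 - A (pluckerPair K).2 0 * h1

lemma mem_colSpan_iff (A : Frame42) (x : Fin 4 → ℂ) :
    x ∈ (colSpan A).1 ↔ ∃ c d : ℂ, ∀ i, x i = c * A.1 i 0 + d * A.1 i 1 := by
  change x ∈ Submodule.span ℂ (Set.range A.1.col) ↔ _
  rw [Submodule.mem_span_range_iff_exists_fun]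
  constructor
  · rintro ⟨c, rfl⟩
    exact ⟨c 0, c 1, fun i => by simp [Fin.sum_univ_two, Matrix.col_apply]⟩
  · rintro ⟨c, d, h⟩
    refine ⟨![c, d], funext fun i => ?_⟩
    simp [Fin.sum_univ_two, Matrix.col_apply, h]

/-- The `2 × 2` minor of a matrix in an arbitrary pair of rows. -/
def rowMinor (A : Matrix (Fin 4) (Fin 2) ℂ) (i j : Fin 4) : ℂ := A i 0 * A j 1 - A i 1 * A j 0

/-- This is `x ∧ a ∧ b = 0` for the columns `a`, `b`: the `3 × 3` minors expanded along `x`. Hence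
the minors up to scale determine the subspace. -/
lemma mem_colSpan_iff_rowMinor (A : Frame42) (x : Fin 4 → ℂ) : x ∈ (colSpan A).1 ↔
    ∀ i j k, x i * rowMinor A.1 j k + x j * rowMinor A.1 k i + x k * rowMinor A.1 i j = 0 := by
  rw [mem_colSpan_iff]
  unfold rowMinor
  constructor
  · rintro ⟨c, d, h⟩ i j k
    rw [h, h, h]
    ring
  · intro h
    obtain ⟨K, hK⟩ := Function.ne_iff.1 (minors_ne_zero A)
    rw [minors_apply, Pi.zero_apply] at hK
    set i := (pluckerPair K).1
    set j := (pluckerPair K).2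
    -- Cramer's rule in the two rows of a non-zero minor.
    refine ⟨(x i * A.1 j 1 - x j * A.1 i 1) / (A.1 i 0 * A.1 j 1 - A.1 i 1 * A.1 j 0),
      (x j * A.1 i 0 - x i * A.1 j 0) / (A.1 i 0 * A.1 j 1 - A.1 i 1 * A.1 j 0), fun k => ?_⟩
    rw [div_mul_eq_mul_div, div_mul_eq_mul_div, ← add_div, eq_div_iff hK]
    linear_combination h i j k

lemma rowMinor_eq_smul {A B : Matrix (Fin 4) (Fin 2) ℂ} {c : ℂ} (h : minors A = c • minors B)
    (i j : Fin 4) : rowMinor A i j = c * rowMinor B i j := by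
  have hk : ∀ K, rowMinor A (pluckerPair K).1 (pluckerPair K).2 =
      c * rowMinor B (pluckerPair K).1 (pluckerPair K).2 := fun K => by
    have := congrFun h K
    rwa [Pi.smul_apply, minors_apply, minors_apply] at this
  have hs : ∀ (M : Matrix (Fin 4) (Fin 2) ℂ) (i j), rowMinor M i j = -rowMinor M j i :=
    fun M i j => by unfold rowMinor; ring
  have h0 : ∀ (M : Matrix (Fin 4) (Fin 2) ℂ) (i), rowMinor M i i = 0 :=
    fun M i => by unfold rowMinor; ring
  have hlt : ∀ i j, i < j → rowMinor A i j = c * rowMinor B i j := by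
    intro i j hij
    obtain ⟨K, rfl, rfl⟩ : ∃ K, (pluckerPair K).1 = i ∧ (pluckerPair K).2 = j := by
      revert i j
      decide
    exact hk K
  rcases lt_trichotomy i j with hij | rfl | hij
  · exact hlt i j hij
  · rw [h0, h0, mul_zero]
  · rw [hs A, hs B, hlt j i hij, mul_neg]

lemma plucker_injective : Function.Injective plucker := by
  intro W W' h
  obtain ⟨A, rfl⟩ := colSpan_surjective W
  obtain ⟨B, rfl⟩ := colSpan_surjective W'
  rw [plucker_colSpan, plucker_colSpan, Projectivization.mk_eq_mk_iff'] at h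
  obtain ⟨c, hc⟩ := h
  have hc0 : c ≠ 0 := by
    rintro rfl
    exact minors_ne_zero A (by rw [← hc, zero_smul])
  refine Subtype.ext (Submodule.ext fun x => ?_)
  rw [mem_colSpan_iff_rowMinor, mem_colSpan_iff_rowMinor]
  refine forall_congr' fun i => forall_congr' fun j => forall_congr' fun k => ?_
  rw [rowMinor_eq_smul hc.symm, rowMinor_eq_smul hc.symm, rowMinor_eq_smul hc.symm,
    show ∀ a b d p q r : ℂ, a * (c * p) + b * (c * q) + d * (c * r) =
      c * (a * p + b * q + d * r) from fun _ _ _ _ _ _ => by ring,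
    mul_eq_zero_iff_left hc0]

lemma plucker_relation (A : Matrix (Fin 4) (Fin 2) ℂ) :
    minors A 0 * minors A 5 + minors A 2 * minors A 3 = minors A 1 * minors A 4 := by
  simp only [minors_apply, pluckerPair, Matrix.cons_val]
  ring

/-- The skew-symmetric matrix with given entries above the diagonal. -/
def skewMatrix (z : Fin 6 → ℂ) : Matrix (Fin 4) (Fin 4) ℂ :=
  !![0, z 0, z 1, z 2; -z 0, 0, z 3, z 4; -z 1, -z 3, 0, z 5; -z 2, -z 4, -z 5, 0]

/-- The matrix with prescribed minors that has an identity block in the rows of index `J`. -/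
noncomputable def frameOfMinors (z : Fin 6 → ℂ) (J : Fin 6) : Matrix (Fin 4) (Fin 2) ℂ :=
  Matrix.of fun k => ![skewMatrix z k (pluckerPair J).2 / z J,
    skewMatrix z (pluckerPair J).1 k / z J]

/-- After clearing denominators, each case is an identity or the Plücker relation up to sign. -/
lemma minors_frameOfMinors {z : Fin 6 → ℂ} (h : z 0 * z 5 + z 2 * z 3 = z 1 * z 4) {J : Fin 6}
    (hJ : z J ≠ 0) : minors (frameOfMinors z J) = (z J)⁻¹ • z := by
  have key : ∀ J K, skewMatrix z (pluckerPair K).1 (pluckerPair J).2 *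
        skewMatrix z (pluckerPair J).1 (pluckerPair K).2 -
      skewMatrix z (pluckerPair J).1 (pluckerPair K).1 *
        skewMatrix z (pluckerPair K).2 (pluckerPair J).2 = z J * z K := by
    intro J K
    fin_cases J <;> fin_cases K <;> simp [skewMatrix, pluckerPair] <;>
      first
      | done
      | ring1
      | linear_combination h
      | linear_combination -h
  funext K
  rw [minors_apply, Pi.smul_apply, smul_eq_mul]
  simp only [frameOfMinors, Matrix.of_apply, Matrix.cons_val_zero, Matrix.cons_val_one]
  have := key J K
  field_simp
  linear_combination this

lemma exists_norm_max (z : Fin 6 → ℂ) (hz : z ≠ 0) : ∃ J, z J ≠ 0 ∧ ∀ K, ‖z K‖ ≤ ‖z J‖ := by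
  obtain ⟨J, hJ⟩ := Finite.exists_max fun K => ‖z K‖
  obtain ⟨K, hK⟩ := Function.ne_iff.1 hz
  exact ⟨J, norm_pos_iff.1 ((norm_pos_iff.2 hK).trans_le (hJ K)), hJ⟩

lemma norm_frameOfMinors_le {z : Fin 6 → ℂ} {J : Fin 6} (hJ : ∀ K, ‖z K‖ ≤ ‖z J‖)
    (i : Fin 4) (k : Fin 2) : ‖frameOfMinors z J i k‖ ≤ 1 := by
  have hs : ∀ i j, ‖skewMatrix z i j‖ ≤ ‖z J‖ := by
    intro i j
    fin_cases i <;> fin_cases j <;> simp [skewMatrix, hJ]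
  fin_cases k <;> simp only [frameOfMinors, Matrix.of_apply, Fin.zero_eta, Fin.mk_one,
    Matrix.cons_val_zero, Matrix.cons_val_one, norm_div] <;>
  exact div_le_one_of_le₀ (hs _ _) (norm_nonneg _)

/-- Dividing by a coordinate of maximal norm keeps the frame bounded and one minor equal to `1`, as
compactness of `Gr42` requires. -/
lemma exists_frame_of_quadric {z : Fin 6 → ℂ} (hz : z ≠ 0)
    (h : z 0 * z 5 + z 2 * z 3 = z 1 * z 4) :
    ∃ A : Frame42, plucker (colSpan A) = Projectivization.mk ℂ z hz ∧
      (∀ i k, ‖A.1 i k‖ ≤ 1) ∧ ∃ J, minors A.1 J = 1 := by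
  obtain ⟨J, hJ, hmax⟩ := exists_norm_max z hz
  have hm := minors_frameOfMinors h hJ
  have hne : minors (frameOfMinors z J) ≠ 0 := by
    rw [hm]
    exact smul_ne_zero (inv_ne_zero hJ) hz
  refine ⟨⟨_, linearIndependent_col_of_minors_ne_zero hne⟩, ?_, norm_frameOfMinors_le hmax, J, ?_⟩
  · rw [plucker_colSpan, Projectivization.mk_eq_mk_iff']
    exact ⟨(z J)⁻¹, hm.symm⟩
  · change minors (frameOfMinors z J) J = 1
    rw [hm, Pi.smul_apply, smul_eq_mul, inv_mul_cancel₀ hJ]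

lemma mk_mem_range_plucker_iff (z : Fin 6 → ℂ) (hz : z ≠ 0) :
    Projectivization.mk ℂ z hz ∈ Set.range plucker ↔ z 0 * z 5 + z 2 * z 3 = z 1 * z 4 := by
  constructor
  · rintro ⟨W, hW⟩
    obtain ⟨A, rfl⟩ := colSpan_surjective W
    rw [plucker_colSpan, Projectivization.mk_eq_mk_iff'] at hW
    obtain ⟨c, hc⟩ := hW
    have hc0 : c ≠ 0 := by
      rintro rfl
      exact minors_ne_zero A (by rw [← hc, zero_smul])
    have := plucker_relation A.1
    simp only [← hc, Pi.smul_apply, smul_eq_mul] at this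
    apply mul_left_cancel₀ (mul_ne_zero hc0 hc0)
    linear_combination this
  · intro h
    obtain ⟨A, hA, -⟩ := exists_frame_of_quadric hz h
    exact ⟨_, hA⟩

lemma continuous_minors : Continuous minors := by
  refine continuous_pi fun K => ?_
  simp only [minors_apply]
  fun_prop

lemma continuous_colSpan : Continuous colSpan := continuous_coinduced_rng

lemma continuous_plucker : Continuous plucker := by
  refine continuous_coinduced_dom.2 ?_
  have : plucker ∘ colSpan = (fun v : {v : Fin 6 → ℂ // v ≠ 0} => Projectivization.mk ℂ v.1 v.2) ∘
      fun A : Frame42 => ⟨minors A.1, minors_ne_zero A⟩ := funext plucker_colSpan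
  rw [this]
  exact (continuous_projectivization_mk 6).comp
    ((continuous_minors.comp continuous_subtype_val).subtype_mk _)

/-- The condition `1 ≤ ∑ ‖minors‖` is closed and still forces independent columns, so bounded frames
satisfying it form a compact set that maps onto `Gr42`. -/
instance : CompactSpace Gr42 := by
  let S : Set (Matrix (Fin 4) (Fin 2) ℂ) :=
    (⋂ i, ⋂ k, {A | ‖A i k‖ ≤ 1}) ∩ {A | 1 ≤ ∑ J, ‖minors A J‖}
  have hS : IsCompact S := by
    have hcl : IsClosed S :=
      (isClosed_iInter fun i => isClosed_iInter fun k =>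
        isClosed_le (continuous_id.matrix_elem i k).norm continuous_const).inter
      (isClosed_le continuous_const (continuous_finsetSum _ fun J _ =>
        ((continuous_apply J).comp continuous_minors).norm))
    refine (isCompact_univ_pi fun _ : Fin 4 => isCompact_univ_pi fun _ : Fin 2 =>
      isCompact_closedBall (0 : ℂ) 1).of_isClosed_subset hcl fun A hA i _ k _ => ?_
    exact mem_closedBall_zero_iff.2 (Set.mem_iInter.1 (Set.mem_iInter.1 hA.1 i) k)
  have hli : ∀ A ∈ S, LinearIndependent ℂ A.col := fun A hA => by
    refine linearIndependent_col_of_minors_ne_zero fun h => ?_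
    have : 1 ≤ ∑ J, ‖minors A J‖ := hA.2
    simp only [h, Pi.zero_apply, norm_zero, Finset.sum_const_zero] at this
    linarith
  have : CompactSpace S := isCompact_iff_compactSpace.1 hS
  have hc : Continuous fun A : S => colSpan ⟨A.1, hli A.1 A.2⟩ :=
    continuous_colSpan.comp (continuous_subtype_val.subtype_mk _)
  suffices hs : Function.Surjective fun A : S => colSpan ⟨A.1, hli A.1 A.2⟩ from
    hs.compactSpace hc
  intro W
  obtain ⟨B, rfl⟩ := colSpan_surjective W
  obtain ⟨A, hA, h1, J, hJ⟩ := exists_frame_of_quadric (minors_ne_zero B) (plucker_relation B.1)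
  rw [← plucker_colSpan] at hA
  refine ⟨⟨A.1, Set.mem_iInter.2 fun i => Set.mem_iInter.2 fun k => h1 i k, ?_⟩,
    plucker_injective hA⟩
  change 1 ≤ ∑ J, ‖minors A.1 J‖
  refine le_trans ?_ (Finset.single_le_sum (fun i _ => norm_nonneg (minors A.1 i))
    (Finset.mem_univ J))
  rw [hJ, norm_one]

lemma isEmbedding_plucker : IsEmbedding plucker :=
  (continuous_plucker.isClosedEmbedding plucker_injective).isEmbedding

lemma plucker_smul (t : Torus 4) (W : Gr42) : plucker (t • W) = t • plucker W := by
  obtain ⟨A, rfl⟩ := colSpan_surjective W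
  let B : Matrix (Fin 4) (Fin 2) ℂ := Matrix.of fun i k => (t i : ℂ) * A.1 i k
  have hB : minors B = torusHom t • minors A.1 := by
    funext K
    simp only [minors_apply, Pi.smul_apply', Circle.smul_def, smul_eq_mul, B, Matrix.of_apply]
    change _ = ((t (pluckerPair K).1 * t (pluckerPair K).2 : Circle) : ℂ) * _
    rw [Circle.coe_mul]
    ring
  have hB0 : minors B ≠ 0 := by
    rw [hB]
    exact (smul_ne_zero_iff_ne _).2 (minors_ne_zero A)
  have hW : t • colSpan A = colSpan ⟨B, linearIndependent_col_of_minors_ne_zero hB0⟩ := by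
    refine Subtype.ext (Submodule.ext fun x => ?_)
    rw [mem_colSpan_iff]
    change x ∈ t • (colSpan A).1 ↔ _
    rw [Submodule.mem_smul_pointwise_iff_exists]
    have hx : ∀ (y : Fin 4 → ℂ) i, (t • y) i = (t i : ℂ) * y i := fun y i => rfl
    constructor
    · rintro ⟨y, hy, rfl⟩
      obtain ⟨c, d, h⟩ := (mem_colSpan_iff A y).1 hy
      refine ⟨c, d, fun i => ?_⟩
      rw [hx, h]
      simp only [B, Matrix.of_apply]
      ring
    · rintro ⟨c, d, h⟩
      refine ⟨fun i => c * A.1 i 0 + d * A.1 i 1, (mem_colSpan_iff A _).2 ⟨c, d, fun _ => rfl⟩,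
        funext fun i => ?_⟩
      rw [hx, h]
      simp only [B, Matrix.of_apply]
      ring
  rw [hW, plucker_colSpan, plucker_colSpan, torus_smul_mk]
  congr 1

/-! ### The join of two spheres -/

lemma continuous_spherePoint {n : ℕ} {X : Type*} [TopologicalSpace X] {f : X → Fin (n + 1) → ℝ}
    (hf : Continuous f) (h : ∀ x, ∑ i, f x i ^ 2 = 1) :
    Continuous fun x => spherePoint (f x) (h x) :=
  ((PiLp.continuous_toLp 2 _).comp hf).subtype_mk _

/-- The Hopf coordinates of a complex line in the plane. -/
noncomputable def hopfCoord (p : CP 1) : Fin 3 → ℝ :=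
  ![2 * (lineProj p 0 0).re - 1, 2 * (lineProj p 0 1).re, 2 * (lineProj p 0 1).im]

lemma sum_hopfCoord_sq (p : CP 1) : ∑ i, hopfCoord p i ^ 2 = 1 := by
  obtain ⟨v, hv, h1, rfl⟩ := exists_unit_rep p
  have h00 : (rankOneProj v 0 0).re = ‖v 0‖ ^ 2 := by
    rw [rankOneProj_diag, h1, div_one, Complex.ofReal_re]
  have h01 : (rankOneProj v 0 1).re ^ 2 + (rankOneProj v 0 1).im ^ 2 = ‖v 0‖ ^ 2 * ‖v 1‖ ^ 2 := by
    have : ‖rankOneProj v 0 1‖ = ‖v 0‖ * ‖v 1‖ := by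
      rw [rankOneProj, h1, Complex.ofReal_one, div_one, norm_mul, RCLike.norm_conj]
    rw [← mul_pow, ← this, ← Complex.normSq_eq_norm_sq, Complex.normSq_apply]
    ring
  rw [Fin.sum_univ_two] at h1
  simp only [hopfCoord, lineProj_mk, Fin.sum_univ_three, Matrix.cons_val, h00]
  have h : ‖v 1‖ ^ 2 = 1 - ‖v 0‖ ^ 2 := by linarith
  rw [h] at h01
  linear_combination 4 * h01

lemma continuous_hopfCoord : Continuous hopfCoord := by
  have h : ∀ i j, Continuous fun p : CP 1 => lineProj p i j := fun i j =>
    (continuous_apply j).comp ((continuous_apply i).comp continuous_lineProj)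
  refine continuous_pi fun i => ?_
  fin_cases i
  · exact (continuous_const.mul (Complex.continuous_re.comp (h 0 0))).sub continuous_const
  · exact continuous_const.mul (Complex.continuous_re.comp (h 0 1))
  · exact continuous_const.mul (Complex.continuous_im.comp (h 0 1))

lemma lineProj_conj {n : ℕ} (p : ℙ ℂ (Fin n → ℂ)) (i j : Fin n) :
    conj (lineProj p i j) = lineProj p j i := by
  induction p using Projectivization.ind with | h v hv =>
  simp only [lineProj_mk, rankOneProj, map_div₀, map_mul, Complex.conj_conj, Complex.conj_ofReal]
  ring

lemma lineProj_diag_im {n : ℕ} (p : ℙ ℂ (Fin n → ℂ)) (i : Fin n) : (lineProj p i i).im = 0 :=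
  Complex.conj_eq_iff_im.1 (lineProj_conj p i i)

lemma hopfCoord_injective : Function.Injective hopfCoord := by
  intro p q h
  have h0 : 2 * (lineProj p 0 0).re - 1 = 2 * (lineProj q 0 0).re - 1 := congrFun h 0
  have h1 : 2 * (lineProj p 0 1).re = 2 * (lineProj q 0 1).re := congrFun h 1
  have h2 : 2 * (lineProj p 0 1).im = 2 * (lineProj q 0 1).im := congrFun h 2
  have e00 : lineProj p 0 0 = lineProj q 0 0 :=
    Complex.ext (by linarith) (by rw [lineProj_diag_im, lineProj_diag_im])
  have e01 : lineProj p 0 1 = lineProj q 0 1 := Complex.ext (by linarith) (by linarith)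
  have e10 : lineProj p 1 0 = lineProj q 1 0 := by
    rw [← lineProj_conj p 0 1, ← lineProj_conj q 0 1, e01]
  have e11 : lineProj p 1 1 = lineProj q 1 1 := by
    have hp := sum_lineProj_diag p
    have hq := sum_lineProj_diag q
    rw [Fin.sum_univ_two] at hp hq
    linear_combination hp - hq - e00
  refine lineProj_injective (funext fun i => funext fun j => ?_)
  fin_cases i <;> fin_cases j
  exacts [e00, e01, e10, e11]

lemma exists_hopfCoord_eq {h : Fin 3 → ℝ} (hh : ∑ i, h i ^ 2 = 1) : ∃ p, hopfCoord p = h := by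
  rw [Fin.sum_univ_three] at hh
  by_cases h0 : 1 + h 0 = 0
  · have e0 : h 0 = -1 := by linarith
    have e1 : h 1 = 0 := by nlinarith [sq_nonneg (h 1), sq_nonneg (h 2)]
    have e2 : h 2 = 0 := by nlinarith [sq_nonneg (h 1), sq_nonneg (h 2)]
    refine ⟨Projectivization.mk ℂ ![0, 1] (by simp), funext fun i => ?_⟩
    fin_cases i <;> simp [hopfCoord, lineProj_mk, rankOneProj, e0, e1, e2]
  -- Twice the first column of the projection with Hopf coordinates `h`; it vanishes only at the
  -- pole `h 0 = -1`, treated above.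
  · let v : Fin 2 → ℂ := ![((1 + h 0 : ℝ) : ℂ), ⟨h 1, -h 2⟩]
    have hv : v ≠ 0 := fun hv => h0 (by
      have : ((1 + h 0 : ℝ) : ℂ) = 0 := congrFun hv 0
      exact_mod_cast this)
    have hN : ∑ k, ‖v k‖ ^ 2 = 2 * (1 + h 0) := by
      rw [Fin.sum_univ_two, ← Complex.normSq_eq_norm_sq, ← Complex.normSq_eq_norm_sq]
      simp only [v, Matrix.cons_val_zero, Matrix.cons_val_one, Complex.normSq_ofReal,
        Complex.normSq_mk]
      nlinarith
    have h00 : rankOneProj v 0 0 = (((1 + h 0) / 2 : ℝ) : ℂ) := by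
      rw [rankOneProj_diag, hN]
      congr 1
      simp only [v, Matrix.cons_val_zero, Complex.norm_real, Real.norm_eq_abs, sq_abs]
      field_simp
    have h01 : rankOneProj v 0 1 = ⟨h 1 / 2, h 2 / 2⟩ := by
      have hc : ((1 + h 0 : ℝ) : ℂ) ≠ 0 := by exact_mod_cast h0
      rw [rankOneProj, hN, Complex.ofReal_mul, div_eq_iff (mul_ne_zero (by norm_num) hc)]
      apply Complex.ext <;> simp [v] <;> ring
    refine ⟨Projectivization.mk ℂ v hv, funext fun i => ?_⟩
    fin_cases i <;> simp only [hopfCoord, lineProj_mk, h00, h01, Fin.zero_eta, Fin.mk_one,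
      Fin.reduceFinMk, Matrix.cons_val, Complex.ofReal_re] <;> ring

/-- The coordinates of the point of the five-sphere given by a point of the join `S² ∗ S²`. -/
noncomputable def joinSphereCoord (x y : Fin 3 → ℝ) (t : ℝ) : Fin 6 → ℝ :=
  ![√(1 - t) * x 0, √(1 - t) * x 1, √(1 - t) * x 2, √t * y 0, √t * y 1, √t * y 2]

lemma sum_joinSphereCoord_sq {x y : Fin 3 → ℝ} (hx : ∑ i, x i ^ 2 = 1) (hy : ∑ i, y i ^ 2 = 1)
    (t : unitInterval) : ∑ i, joinSphereCoord x y t i ^ 2 = 1 := by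
  rw [Fin.sum_univ_three] at hx hy
  simp only [joinSphereCoord, Fin.sum_univ_six, Matrix.cons_val, mul_pow,
    Real.sq_sqrt (sub_nonneg.2 t.2.2), Real.sq_sqrt t.2.1]
  linear_combination (1 - (t : ℝ)) * hx + (t : ℝ) * hy

/-- The square roots in `joinSphereCoord` make the join parameter readable from the image point, as
injectivity requires. -/
lemma joinSphereCoord_time {x y : Fin 3 → ℝ} (hy : ∑ i, y i ^ 2 = 1) (t : unitInterval) :
    joinSphereCoord x y t 3 ^ 2 + joinSphereCoord x y t 4 ^ 2 + joinSphereCoord x y t 5 ^ 2 = t := by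
  rw [Fin.sum_univ_three] at hy
  simp only [joinSphereCoord, Matrix.cons_val, mul_pow, Real.sq_sqrt t.2.1]
  linear_combination (t : ℝ) * hy

/-- The map of the join `S² ∗ ℂP¹` to the five-sphere. -/
noncomputable def joinToSphere : Join (USphere 2) (CP 1) → USphere 5 :=
  Quotient.lift (fun q => spherePoint (joinSphereCoord q.1.1 (hopfCoord q.2.1) q.2.2)
      (sum_joinSphereCoord_sq (sum_sq_eq_one_of_mem_sphere q.1) (sum_hopfCoord_sq q.2.1) q.2.2)) (by
    rintro ⟨x, y, t⟩ ⟨x', y', t'⟩ (h | ⟨h1, h2, h3⟩ | ⟨h1, h2, h3⟩)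
    · rw [h]
    · simp only at h1 h2 h3
      simp [h1, h2, h3, joinSphereCoord]
    · simp only at h1 h2 h3
      simp [h1, h2, h3, joinSphereCoord])

lemma joinToSphere_mk (x : USphere 2) (y : CP 1) (t : unitInterval) (i : Fin 6) :
    (joinToSphere (Join.mk x y t)).1 i = joinSphereCoord x.1 (hopfCoord y) t i := rfl

lemma continuous_joinToSphere : Continuous joinToSphere := by
  refine Continuous.quotient_lift (continuous_spherePoint ?_ _) _
  have hh := continuous_hopfCoord
  refine continuous_pi fun i => ?_
  fin_cases i <;> simp only [joinSphereCoord, Fin.zero_eta, Fin.mk_one, Fin.reduceFinMk,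
    Matrix.cons_val] <;> fun_prop

lemma joinToSphere_injective : Function.Injective joinToSphere := by
  intro p q h
  obtain ⟨x, y, t, rfl⟩ := p.exists_mk
  obtain ⟨x', y', t', rfl⟩ := q.exists_mk
  have hi : ∀ i, joinSphereCoord x.1 (hopfCoord y) t i = joinSphereCoord x'.1 (hopfCoord y') t' i :=
    fun i => by rw [← joinToSphere_mk, ← joinToSphere_mk, h]
  have htt : t = t' := Subtype.ext (by
    rw [← joinSphereCoord_time (x := x.1) (sum_hopfCoord_sq y) t,
      ← joinSphereCoord_time (x := x'.1) (sum_hopfCoord_sq y') t', hi, hi, hi])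
  subst htt
  have hx : t ≠ 1 → x = x' := fun ht => by
    have hpos : √(1 - (t : ℝ)) ≠ 0 := (Real.sqrt_pos.2 (sub_pos.2
      (lt_of_le_of_ne t.2.2 fun h => ht (Subtype.ext h)))).ne'
    refine sphere_ext fun i => mul_left_cancel₀ hpos ?_
    fin_cases i
    exacts [hi 0, hi 1, hi 2]
  have hy : t ≠ 0 → y = y' := fun ht => by
    have hpos : √(t : ℝ) ≠ 0 := (Real.sqrt_pos.2
      (lt_of_le_of_ne t.2.1 fun h => ht (Subtype.ext h.symm))).ne'
    refine hopfCoord_injective (funext fun i => mul_left_cancel₀ hpos ?_)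
    fin_cases i
    exacts [hi 3, hi 4, hi 5]
  by_cases h0 : t = 0
  · rw [hx (by rw [h0]; exact zero_ne_one), h0]
    exact Join.mk_eq_mk_zero _ _ _
  · rw [hy h0]
    by_cases h1 : t = 1
    · rw [h1]
      exact Join.mk_eq_mk_one _ _ _
    · rw [hx h1]

lemma exists_eq_sqrt_mul (a : Fin 3 → ℝ) :
    ∃ x : USphere 2, ∀ i, a i = √(∑ k, a k ^ 2) * x.1 i := by
  by_cases ha : a = 0
  · refine ⟨spherePoint ![1, 0, 0] (by simp [Fin.sum_univ_three]), fun i => ?_⟩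
    simp [ha]
  · obtain ⟨x, c, hc, hx⟩ := exists_spherePoint_smul ha
    refine ⟨x, fun i => ?_⟩
    simp only [hx, mul_pow]
    rw [← Finset.mul_sum, sum_sq_eq_one_of_mem_sphere, mul_one, Real.sqrt_sq hc.le]

lemma joinToSphere_surjective : Function.Surjective joinToSphere := by
  intro s
  have hs := sum_sq_eq_one_of_mem_sphere s
  rw [Fin.sum_univ_six] at hs
  obtain ⟨x, hx⟩ := exists_eq_sqrt_mul ![s.1 0, s.1 1, s.1 2]
  obtain ⟨y', hy⟩ := exists_eq_sqrt_mul ![s.1 3, s.1 4, s.1 5]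
  obtain ⟨y, hy'⟩ := exists_hopfCoord_eq (sum_sq_eq_one_of_mem_sphere y')
  simp only [Fin.sum_univ_three, Matrix.cons_val, ← hy'] at hx hy
  let t : unitInterval := ⟨s.1 3 ^ 2 + s.1 4 ^ 2 + s.1 5 ^ 2, by positivity,
    by nlinarith [sq_nonneg (s.1 0), sq_nonneg (s.1 1), sq_nonneg (s.1 2)]⟩
  have ht : 1 - (t : ℝ) = s.1 0 ^ 2 + s.1 1 ^ 2 + s.1 2 ^ 2 := by
    change 1 - (s.1 3 ^ 2 + s.1 4 ^ 2 + s.1 5 ^ 2) = _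
    linarith
  refine ⟨Join.mk x y t, sphere_ext fun i => ?_⟩
  rw [joinToSphere_mk, joinSphereCoord, ht]
  fin_cases i
  exacts [(hx 0).symm, (hx 1).symm, (hx 2).symm, (hy 0).symm, (hy 1).symm, (hy 2).symm]

lemma nonempty_join_homeomorph_sphere : Nonempty (Join (USphere 2) (CP 1) ≃ₜ USphere 5) :=
  ⟨Continuous.homeoOfEquivCompactToT2
    (f := Equiv.ofBijective joinToSphere ⟨joinToSphere_injective, joinToSphere_surjective⟩)
    continuous_joinToSphere⟩

/-! ### The line in the projective plane -/

/-- The injective linear map `(a, b) ↦ (a, b, b - a)`. -/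
def pluckerLine : (Fin 2 → ℂ) →ₗ[ℂ] (Fin 3 → ℂ) where
  toFun v := ![v 0, v 1, v 1 - v 0]
  map_add' v w := by
    simp only [Pi.add_apply, Matrix.vec3_add, add_sub_add_comm]
  map_smul' c v := by
    simp only [Pi.smul_apply, Matrix.smul_vec3, smul_sub, RingHom.id_apply]

lemma pluckerLine_apply (v : Fin 2 → ℂ) : pluckerLine v = ![v 0, v 1, v 1 - v 0] := rfl

lemma pluckerLine_injective : Function.Injective pluckerLine := by
  intro v w h
  rw [pluckerLine_apply, pluckerLine_apply] at h
  funext i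
  fin_cases i
  exacts [congrFun h 0, congrFun h 1]

/-- The embedding of `ℂP¹` in `ℂP²` as the line `c₁ + 1 = c₂`. -/
noncomputable def pluckerLineMap : CP 1 → CP 2 :=
  Projectivization.map pluckerLine pluckerLine_injective

lemma pluckerLineMap_mk (v : Fin 2 → ℂ) (hv : v ≠ 0) :
    pluckerLineMap (Projectivization.mk ℂ v hv) = Projectivization.mk ℂ (pluckerLine v)
      ((map_ne_zero_iff _ pluckerLine_injective).2 hv) := rfl

lemma pluckerLineMap_injective : Function.Injective pluckerLineMap :=
  Projectivization.map_injective _ _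

lemma isEmbedding_pluckerLineMap : IsEmbedding pluckerLineMap := by
  have h : Continuous pluckerLineMap := by
    have hc : Continuous fun v : {v : Fin 2 → ℂ // v ≠ 0} =>
        (⟨pluckerLine v.1, (map_ne_zero_iff _ pluckerLine_injective).2 v.2⟩ :
          {v : Fin 3 → ℂ // v ≠ 0}) :=
      (pluckerLine.continuous_of_finiteDimensional.comp continuous_subtype_val).subtype_mk _
    exact continuous_projectivization_iff.2 ((continuous_projectivization_mk 3).comp hc)
  exact (h.isClosedEmbedding pluckerLineMap_injective).isEmbedding

/-- The Plücker relation is linear in the products of opposite coordinates; this is why the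
Grassmannian corresponds to a projective line. -/
lemma oppProd_of_quadric {z : Fin 6 → ℂ} (h : z 0 * z 5 + z 2 * z 3 = z 1 * z 4) :
    oppProd z = pluckerLine ![z 2 * z 3, z 1 * z 4] := by
  rw [pluckerLine_apply]
  funext k
  fin_cases k <;> simp [oppProd, posIdx, negIdx]
  linear_combination h

lemma quadric_of_oppProd {z : Fin 6 → ℂ} {v : Fin 2 → ℂ} {r : ℂ}
    (h : oppProd z = r • pluckerLine v) : z 0 * z 5 + z 2 * z 3 = z 1 * z 4 := by
  rw [pluckerLine_apply] at h
  have h0 : z 2 * z 3 = r * v 0 := congrFun h 0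
  have h1 : z 1 * z 4 = r * v 1 := congrFun h 1
  have h2 : z 0 * z 5 = r * (v 1 - v 0) := congrFun h 2
  linear_combination h0 - h1 + h2

/-! ### The orbit spaces -/

/-- The map of the orbit space `ℂP⁵ / T⁴` to the model. -/
noncomputable def cpOrbitsToModel : CPOrbits → JoinModel :=
  Quotient.lift cpToModel fun p q h => by
    obtain ⟨t, rfl⟩ := MulAction.orbitRel_apply.1 h
    exact cpToModel_torus_smul t q

lemma continuous_cpOrbitsToModel : Continuous cpOrbitsToModel :=
  continuous_cpToModel.quotient_lift _

lemma cpOrbitsToModel_injective : Function.Injective cpOrbitsToModel := by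
  intro p q h
  induction p using Quotient.ind with | _ p =>
  induction q using Quotient.ind with | _ q =>
  exact Quotient.sound (MulAction.orbitRel_apply.2 (exists_torus_smul_of_cpToModel_eq h))

/-- Together with compactness of `Gr42` this makes `pluckerOrbits` a closed embedding. -/
instance : T2Space CPOrbits :=
  T2Space.of_injective_continuous cpOrbitsToModel_injective continuous_cpOrbitsToModel

/-- The map of orbit spaces induced by the Plücker map. -/
noncomputable def pluckerOrbits : GrOrbits → CPOrbits :=
  Quotient.map plucker fun V W h => by
    obtain ⟨t, rfl⟩ := MulAction.orbitRel_apply.1 h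
    exact MulAction.orbitRel_apply.2 ⟨t, (plucker_smul t W).symm⟩

lemma pluckerOrbits_mk (W : Gr42) :
    pluckerOrbits (Quotient.mk _ W) = Quotient.mk _ (plucker W) := rfl

lemma continuous_pluckerOrbits : Continuous pluckerOrbits :=
  continuous_plucker.quotient_map' _

lemma pluckerOrbits_injective : Function.Injective pluckerOrbits := by
  intro V W h
  induction V using Quotient.ind with | _ V =>
  induction W using Quotient.ind with | _ W =>
  obtain ⟨t, ht⟩ := MulAction.orbitRel_apply.1 (Quotient.exact h)
  refine Quotient.sound (MulAction.orbitRel_apply.2 ⟨t, plucker_injective ?_⟩)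
  exact (plucker_smul t W).trans ht

lemma isEmbedding_pluckerOrbits : IsEmbedding pluckerOrbits :=
  (continuous_pluckerOrbits.isClosedEmbedding pluckerOrbits_injective).isEmbedding

lemma range_cpOrbitsToModel (θ : USphere 2 ≃ₜ hypersimplex42Boundary) :
    Set.range cpOrbitsToModel = Set.range (joinToModel θ (lineProj : CP 2 → _)) := by
  ext m
  constructor
  · rintro ⟨p, rfl⟩
    induction p using Quotient.ind with | _ p =>
    induction p using Projectivization.ind with | h z hz =>
    obtain ⟨y, hy⟩ : ∃ y : CP 2, oppProd z ≠ 0 → rankOneProj (oppProd z) = lineProj y := by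
      by_cases h : oppProd z = 0
      -- Over the boundary any point of `ℂP²` will do.
      · exact ⟨Projectivization.mk ℂ ![1, 0, 0] (by simp), fun h' => absurd h h'⟩
      · exact ⟨Projectivization.mk ℂ _ h, fun _ => rfl⟩
    obtain ⟨x, t, h⟩ := exists_joinToModel_eq θ lineProj z hz y hy
    exact ⟨_, h.symm⟩
  · rintro ⟨q, rfl⟩
    obtain ⟨x, y, t, rfl⟩ := q.exists_mk
    induction y using Projectivization.ind with | h w hw =>
    obtain ⟨z, hz, -, -, h⟩ := exists_cpToModel_eq θ lineProj x (Projectivization.mk ℂ w hw) t hw rfl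
    exact ⟨Quotient.mk _ (Projectivization.mk ℂ z hz), h⟩

lemma range_cpOrbitsToModel_comp_pluckerOrbits (θ : USphere 2 ≃ₜ hypersimplex42Boundary) :
    Set.range (cpOrbitsToModel ∘ pluckerOrbits) =
      Set.range (joinToModel θ (lineProj ∘ pluckerLineMap)) := by
  ext m
  constructor
  · rintro ⟨W, rfl⟩
    induction W using Quotient.ind with | _ W =>
    obtain ⟨A, rfl⟩ := colSpan_surjective W
    have ho := oppProd_of_quadric (plucker_relation A.1)
    obtain ⟨y, hy⟩ : ∃ y : CP 1, oppProd (minors A.1) ≠ 0 →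
        rankOneProj (oppProd (minors A.1)) = (lineProj ∘ pluckerLineMap) y := by
      by_cases h : oppProd (minors A.1) = 0
      · exact ⟨Projectivization.mk ℂ ![1, 0] (by simp), fun h' => absurd h h'⟩
      · rw [ho] at h ⊢
        exact ⟨Projectivization.mk ℂ _ ((map_ne_zero_iff _ pluckerLine_injective).1 h), fun _ => rfl⟩
    obtain ⟨x, t, h⟩ := exists_joinToModel_eq θ _ _ (minors_ne_zero A) y hy
    rw [← plucker_colSpan] at h
    exact ⟨_, h.symm⟩
  · rintro ⟨q, rfl⟩
    obtain ⟨x, y, t, rfl⟩ := q.exists_mk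
    induction y using Projectivization.ind with | h v hv =>
    obtain ⟨z, hz, r, hr, h⟩ := exists_cpToModel_eq θ (lineProj ∘ pluckerLineMap) x
      (Projectivization.mk ℂ v hv) t ((map_ne_zero_iff _ pluckerLine_injective).2 hv) rfl
    obtain ⟨W, hW⟩ := (mk_mem_range_plucker_iff z hz).2 (quadric_of_oppProd hr)
    rw [← hW] at h
    exact ⟨Quotient.mk _ W, h⟩

/-! ### Assembly of the homeomorphisms and their compatibilities. -/

theorem mainTheorem5 :
    -- the Plücker map is an embedding onto a quadric hypersurface and is equivariant
    Topology.IsEmbedding plucker ∧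
    (∀ (z : Fin 6 → ℂ) (hz : z ≠ 0), Projectivization.mk ℂ z hz ∈ Set.range plucker ↔
      z 0 * z 5 + z 2 * z 3 = z 1 * z 4) ∧
    (∀ (t : Torus 4) (W : Gr42), plucker (t • W) = t • plucker W) ∧
    -- it induces an embedding of orbit spaces
    ∃ ι : GrOrbits → CPOrbits,
      (∀ W : Gr42, ι (Quotient.mk _ W) = Quotient.mk _ (plucker W)) ∧
      Topology.IsEmbedding ι ∧
      Nonempty (GrOrbits ≃ₜ USphere 5) ∧
      -- the embedding of `ℂP¹` in `ℂP²` as a line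
      ∃ j : CP 1 → CP 2, Topology.IsEmbedding j ∧
        (∀ c : ℂ, j (Projectivization.mk ℂ ![c, 1] (by simp)) =
          Projectivization.mk ℂ ![c, 1, 1 - c] (by simp)) ∧
        j (Projectivization.mk ℂ ![1, 0] (by simp)) =
          Projectivization.mk ℂ ![1, 0, -1] (by simp) ∧
        -- the identifications of the orbit spaces with joins
        ∃ (θ : USphere 2 ≃ₜ hypersimplex42Boundary)
          (hG : GrOrbits ≃ₜ Join (USphere 2) (CP 1))
          (hP : CPOrbits ≃ₜ Join (USphere 2) (CP 2)),
          -- compatibility with the moment maps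
          (∀ W : Gr42, ∃ x y t, hG (Quotient.mk _ W) = Join.mk x y t ∧
            moment (plucker W) = hypersimplex42Center +
              (1 - (t : ℝ)) • ((θ x : Fin 4 → ℝ) - hypersimplex42Center)) ∧
          (∀ p : CP 5, ∃ x y t, hP (Quotient.mk _ p) = Join.mk x y t ∧
            moment p = hypersimplex42Center +
              (1 - (t : ℝ)) • ((θ x : Fin 4 → ℝ) - hypersimplex42Center)) ∧
          -- compatibility with the parameters of the main strata
          (∀ (A : Frame42) (a₅ a₆ a₇ a₈ : ℂ), A.1 = !![1, 0; 0, 1; a₅, a₆; a₇, a₈] →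
            a₅ ≠ 0 → a₆ ≠ 0 → a₇ ≠ 0 → a₈ ≠ 0 → a₅ * a₈ - a₆ * a₇ ≠ 0 →
            ∃ x t, hG (Quotient.mk _ (colSpan A)) =
              Join.mk x (Projectivization.mk ℂ ![a₅ * a₈ / (a₆ * a₇), 1] (by simp)) t) ∧
          (∀ (z : Fin 6 → ℂ) (hz : z ≠ 0), (∀ k, z k ≠ 0) →
            ∃ x t, hP (Quotient.mk _ (Projectivization.mk ℂ z hz)) =
              Join.mk x (Projectivization.mk ℂ
                ![z 2 * z 3 / (z 0 * z 5), z 1 * z 4 / (z 0 * z 5), 1] (by simp)) t) ∧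
          -- the induced embedding is `id ∗ j`
          (∀ q : GrOrbits, hP (ι q) = Join.mapRight j (hG q)) := by
  refine ⟨isEmbedding_plucker, mk_mem_range_plucker_iff, plucker_smul, pluckerOrbits,
    pluckerOrbits_mk, isEmbedding_pluckerOrbits, ?_⟩
  obtain ⟨θ⟩ := nonempty_sphere_homeomorph_boundary
  have hjinj : Function.Injective (joinToModel θ (lineProj ∘ pluckerLineMap)) :=
    joinToModel_injective θ (lineProj_injective.comp pluckerLineMap_injective)
      fun _ => sum_lineProj_diag _
  have hpinj : Function.Injective (joinToModel θ (lineProj : CP 2 → _)) :=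
    joinToModel_injective θ lineProj_injective fun _ => sum_lineProj_diag _
  obtain ⟨hG, hG'⟩ := exists_homeomorph_of_range_eq
    (continuous_cpOrbitsToModel.comp continuous_pluckerOrbits)
    (cpOrbitsToModel_injective.comp pluckerOrbits_injective)
    (continuous_joinToModel θ (continuous_lineProj.comp isEmbedding_pluckerLineMap.continuous))
    hjinj (range_cpOrbitsToModel_comp_pluckerOrbits θ)
  obtain ⟨hP, hP'⟩ := exists_homeomorph_of_range_eq continuous_cpOrbitsToModel
    cpOrbitsToModel_injective (continuous_joinToModel θ continuous_lineProj) hpinj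
    (range_cpOrbitsToModel θ)
  refine ⟨nonempty_join_homeomorph_sphere.map hG.trans, pluckerLineMap,
    isEmbedding_pluckerLineMap, fun c => ?_, ?_, θ, hG, hP, fun W => ?_, fun p => ?_, ?_, ?_,
    fun q => ?_⟩
  · simp only [pluckerLineMap_mk, pluckerLine_apply, Matrix.cons_val_zero, Matrix.cons_val_one]
  · simp only [pluckerLineMap_mk, pluckerLine_apply, Matrix.cons_val_zero, Matrix.cons_val_one,
      zero_sub]
  · obtain ⟨x, y, t, h⟩ := (hG (Quotient.mk _ W)).exists_mk
    refine ⟨x, y, t, h, ?_⟩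
    have := hG' (Quotient.mk _ W)
    rw [h] at this
    exact congrArg Prod.fst this.symm
  · obtain ⟨x, y, t, h⟩ := (hP (Quotient.mk _ p)).exists_mk
    refine ⟨x, y, t, h, ?_⟩
    have := hP' (Quotient.mk _ p)
    rw [h] at this
    exact congrArg Prod.fst this.symm
  · intro A a₅ a₆ a₇ a₈ hA h5 h6 h7 h8 hd
    -- For this frame `z₂z₃ = -a₅a₈` and `z₁z₄ = -a₆a₇`, which gives the factor and the ratio `c`.
    have ho : oppProd (minors A.1) =
        (-(a₆ * a₇)) • pluckerLine ![a₅ * a₈ / (a₆ * a₇), 1] := by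
      rw [oppProd_of_quadric (plucker_relation A.1), ← map_smul]
      congr 1
      simp only [minors_apply, pluckerPair, hA, Matrix.smul_vec2]
      congr 1
      · simp
        field_simp
      · simp
    obtain ⟨x, t, h⟩ := exists_joinToModel_eq θ (lineProj ∘ pluckerLineMap) _ (minors_ne_zero A)
      (Projectivization.mk ℂ ![a₅ * a₈ / (a₆ * a₇), 1] (by simp)) (fun _ => by
        rw [ho, rankOneProj_smul (neg_ne_zero.2 (mul_ne_zero h6 h7))]
        rfl)
    refine ⟨x, t, hjinj ?_⟩
    rw [hG', ← h, ← plucker_colSpan]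
    rfl
  · intro z hz hk
    have ho : oppProd z = (z 0 * z 5) •
        ![z 2 * z 3 / (z 0 * z 5), z 1 * z 4 / (z 0 * z 5), 1] := by
      have h0 := hk 0
      have h5 := hk 5
      funext k
      fin_cases k <;> simp [oppProd, posIdx, negIdx] <;> field_simp
    obtain ⟨x, t, h⟩ := exists_joinToModel_eq θ lineProj z hz
      (Projectivization.mk ℂ ![z 2 * z 3 / (z 0 * z 5), z 1 * z 4 / (z 0 * z 5), 1] (by simp))
      (fun _ => by
        rw [ho, rankOneProj_smul (mul_ne_zero (hk 0) (hk 5))]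
        rfl)
    refine ⟨x, t, hpinj ?_⟩
    rw [hP', ← h]
    rfl
  -- In the model, `id ∗ j` is precomposition of `lineProj` with `j`, and both homeomorphisms
  -- preserve the image in the model.
  · apply hpinj
    rw [joinToModel_mapRight, hG', hP']
    rfl
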